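/- Let $\Omega/k$ be a (possibly infinite) Galois extension of fields and put $\Gamma=\mathrm{Aut}(\Omega/k)$. An *algebraic scheme* over a field is a separated scheme of finite type over it. For a homomorphism of fields $i\colon F\to L$ and a scheme $V$ over $F$ write $iV=V\times_{\operatorname{Spec}F}\operatorname{Spec}L$ (also $V_L$), and similarly $i\varphi$ for morphisms; canonically $j(iV)=(j\circ i)V$. Let $V$ be an algebraic scheme over $\Omega$. A *descent system* on $V$ is a family of isomorphisms $\varphi_\sigma\colon\sigma V\to V$ of $\Omega$-schemes $(\sigma\in\Gamma)$ with $\varphi_\sigma\circ(\sigma\varphi_\tau)=\varphi_{\sigma\tau}$ for all $\sigma,\tau\in\Gamma$. A *model* of $V$ over a field $K$ with $k\subset K\subset\Omega$ is an algebraic scheme $V_0$ over $K$ together with an isomorphism $\varphi\colon V\to V_{0\Omega}$; it *splits* the descent system if $\varphi_\sigma=\varphi^{-1}\circ\sigma\varphi$ for all $\sigma\in\Gamma$ fixing $K$ (where $\sigma(V_{0\Omega})=V_{0\Omega}$). A *descent datum* is a descent system that is split by some model over a subfield $K\supset k$ of $\Omega$ finitely generated over $k$. It is *effective* if it is split by some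 model over $k$. Every descent datum on $V$ is effective in each of the following cases: (a) $V$ is quasi-projective, i.e., isomorphic over $\Omega$ to a locally closed subscheme of some $\mathbb{P}^n_\Omega$; (b) there is an affine algebraic group $G$ over $\Omega$ (an affine group scheme of finite type) with an action on $V$ that is transitive, i.e., $G(\Omega^{\mathrm{al}})$ acts transitively on $V(\Omega^{\mathrm{al}})$ for an algebraic closure $\Omega^{\mathrm{al}}$ of $\Omega$; (c) for some separable closure $\Omega^{\mathrm{sep}}$ of $\Omega$, every finite set of closed points of $V_{\Omega^{\mathrm{sep}}}$ is contained in an open affine subscheme of $V_{\Omega^{\mathrm{sep}}}$; (d) $k$ is perfect and, for some separable closure $\Omega^{\mathrm{sep}}$ of $\Omega$, every finite set of points of $V(\Omega^{\mathrm{sep}})$ is contained in an open affine subscheme of $V_{\Omega^{\mathrm{sep}}}$. -/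

import Mathlib

open CategoryTheory Limits AlgebraicGeometry

universe u

noncomputable section

namespace FieldDescent

/-- Schemes over the field `F`, as objects of the category of `F`-schemes and `F`-morphisms. -/
abbrev Sch (F : Type u) [Field F] := Over (Spec (CommRingCat.of F))

/-- An algebraic scheme over a field: a separated scheme of finite type. -/
structure IsAlgebraicScheme {F : Type u} [Field F] (X : Sch F) : Prop where
  isSeparated : IsSeparated X.hom
  locallyOfFiniteType : LocallyOfFiniteType X.hom
  quasiCompact : QuasiCompact X.hom

section BaseChange

variable {F L M : Type u} [Field F] [Field L] [Field M]

/-- The morphism `Spec L ⟶ Spec F` given by a homomorphism of fields `i : F → L`. -/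
abbrev specMap (i : F →+* L) : Spec (CommRingCat.of L) ⟶ Spec (CommRingCat.of F) :=
  Spec.map (CommRingCat.ofHom i)

/-- The functor `V ↦ iV = V ×_{Spec F} Spec L` attached to a homomorphism of fields `i : F → L`. -/
abbrev baseChange (i : F →+* L) : Sch F ⥤ Sch L := Over.pullback (specMap i)

/-- The canonical identification `j(iV) = (j ∘ i)V`. -/
def baseChangeComp {i : F →+* L} {j : L →+* M} {l : F →+* M} (h : j.comp i = l) (V : Sch F) :
    (baseChange j).obj ((baseChange i).obj V) ≅ (baseChange l).obj V :=
  Over.isoMk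
    (pullbackLeftPullbackSndIso V.hom (specMap i) (specMap j) ≪≫
      pullback.congrHom rfl (by rw [← h]; exact (Spec.map_comp _ _).symm))
    (by
      simp only [Over.pullback_obj_hom, Over.pullback_obj_left, Iso.trans_hom, pullback.congrHom_hom,
        Category.assoc]
      rw [pullback.lift_snd]
      simp)

/-- The identification `j(iV) = (j ∘ i)V` is compatible with the projections to `V`. -/
lemma baseChangeComp_hom_left_fst {i : F →+* L} {j : L →+* M} {l : F →+* M} (h : j.comp i = l)
    (V : Sch F) :
    (baseChangeComp h V).hom.left ≫ pullback.fst V.hom (specMap l) =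
      pullback.fst (pullback.snd V.hom (specMap i)) (specMap j) ≫
        pullback.fst V.hom (specMap i) := by
  simp only [baseChangeComp, Over.isoMk_hom_left, Iso.trans_hom, pullback.congrHom_hom,
    Category.assoc]
  rw [pullback.lift_fst]
  simp

end BaseChange

section Descent

/-- A model of the scheme `V` over `Ω` with respect to `i : F → Ω` (in the applications, the
inclusion of a subfield): an algebraic scheme `V₀` over `F` with an isomorphism `φ : V ≅ V₀_Ω`. -/
structure Model {F Ω : Type u} [Field F] [Field Ω] (i : F →+* Ω) (V : Sch Ω) where
  V₀ : Sch F
  isAlgebraicScheme : IsAlgebraicScheme V₀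
  φ : V ≅ (baseChange i).obj V₀

variable (k : Type u) {Ω : Type u} [Field k] [Field Ω] [Algebra k Ω]

lemma coe_comp_coe (σ τ : Ω ≃ₐ[k] Ω) :
    (σ : Ω →+* Ω).comp (τ : Ω →+* Ω) = ((σ * τ : Ω ≃ₐ[k] Ω) : Ω →+* Ω) := rfl

/-- An `Ω/k`-descent system on `V`: isomorphisms `φ_σ : σV ≅ V` of `Ω`-schemes, for
`σ ∈ Aut(Ω/k)`, such that `φ_σ ∘ σφ_τ = φ_{στ}` on `σ(τV) = (στ)V`. -/
structure DescentSystem (V : Sch Ω) where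
  φ (σ : Ω ≃ₐ[k] Ω) : (baseChange (σ : Ω →+* Ω)).obj V ≅ V
  cocycle (σ τ : Ω ≃ₐ[k] Ω) :
    (baseChange (σ : Ω →+* Ω)).map (φ τ).hom ≫ (φ σ).hom =
      (baseChangeComp (coe_comp_coe k σ τ) V).hom ≫ (φ (σ * τ)).hom

variable {k}

/-- The model `(V₀, φ)` over `F` splits the descent system `(φ_σ)`: one has
`φ_σ = φ⁻¹ ∘ σφ` on `σV`, where `σ(V₀_Ω) = V₀_Ω`, for all `σ ∈ Aut(Ω/k)` fixing `F`. -/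
def Model.Splits {F : Type u} [Field F] {i : F →+* Ω} {V : Sch Ω} (M : Model i V)
    (D : DescentSystem k V) : Prop :=
  ∀ (σ : Ω ≃ₐ[k] Ω) (hσ : (σ : Ω →+* Ω).comp i = i),
    (D.φ σ).hom =
      (baseChange (σ : Ω →+* Ω)).map M.φ.hom ≫ (baseChangeComp hσ M.V₀).hom ≫ M.φ.inv

/-- A descent system is continuous if it is split by some model over an intermediate field
that is finitely generated over `k`. A descent datum is a continuous descent system. -/
def DescentSystem.IsContinuous {V : Sch Ω} (D : DescentSystem k V) : Prop :=
  ∃ K : IntermediateField k Ω, K.FG ∧ ∃ M : Model (algebraMap K Ω) V, M.Splits D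

/-- A descent system is effective if it is split by some model over `k`. -/
def DescentSystem.IsEffective {V : Sch Ω} (D : DescentSystem k V) : Prop :=
  ∃ M : Model (algebraMap k Ω) V, M.Splits D

variable (k) in
/-- Every `Ω/k`-descent datum (that is, continuous descent system) on `V` is effective. -/
def DescentIsEffective (V : Sch Ω) : Prop :=
  ∀ D : DescentSystem k V, D.IsContinuous → D.IsEffective

end Descent

section Conditions

variable {F : Type u} [Field F]

attribute [local instance] MvPolynomial.gradedAlgebra

/-- Projective `n`-space over `F`, as the `F`-scheme `Proj F[X₀, …, Xₙ]`. -/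
def projectiveSpace (n : ℕ) (F : Type u) [Field F] : Sch F :=
  Over.mk (Proj.toSpecZero (MvPolynomial.homogeneousSubmodule (Fin (n + 1)) F) ≫
    Spec.map (CommRingCat.ofHom
      (algebraMap F (MvPolynomial.homogeneousSubmodule (Fin (n + 1)) F 0))))

/-- A scheme over `F` is quasi-projective if it is isomorphic to a (locally closed) subscheme of
some projective space over `F`. -/
def IsQuasiProjective (V : Sch F) : Prop :=
  ∃ (n : ℕ) (j : V ⟶ projectiveSpace n F), IsImmersion j.left

open MonoidalCategory CartesianMonoidalCategory MonObj in
/-- The action of the group scheme `G` on `V` is transitive: `G(Fᵃˡ)` acts transitively on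
`V(Fᵃˡ)`, where `Fᵃˡ` is an algebraic closure of `F`. -/
def ActsTransitively (G V : Sch F) [GrpObj G] [ModObj G V] : Prop :=
  ∀ x y : Over.mk (specMap (algebraMap F (AlgebraicClosure F))) ⟶ V,
    ∃ g : Over.mk (specMap (algebraMap F (AlgebraicClosure F))) ⟶ G,
      lift g x ≫ γ[G, V] = y

/-- Every finite set of closed points of the scheme `X` is contained in an open affine. -/
def FiniteClosedSetsInAffine (X : Scheme.{u}) : Prop :=
  ∀ S : Set X, S.Finite → (∀ x ∈ S, IsClosed {x}) →
    ∃ U : X.Opens, IsAffineOpen U ∧ S ⊆ U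

/-- Every finite set of `F`-rational points of the `F`-scheme `X` is contained in an open affine. -/
def FiniteRationalSetsInAffine (X : Sch F) : Prop :=
  ∀ S : Set (Over.mk (𝟙 (Spec (CommRingCat.of F))) ⟶ X), S.Finite →
    ∃ U : X.left.Opens, IsAffineOpen U ∧ ∀ s ∈ S, Set.range s.left ⊆ (U : Set X.left)

end Conditions

end FieldDescent

end

noncomputable section

/-! A descent system amounts to a semilinear action: the inverse of `φ σ` followed by the projection
σV → V lies over Spec σ and is multiplicative in σ. A model splits the system exactly when the
projection onto it is invariant under the automorphisms fixing its field (`Model.splits_iff`), so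
effectivity asks for an invariant cartesian square over Spec Ω → Spec k. A splitting over a finitely
generated K makes the action continuous: quasi-compact opens have finite orbits, and sections over
stable affine opens have open stabilizers.

All cases go through `descentIsEffective_of_finiteClosedSetsInAffine`: it is enough that finite sets
of closed points of V lie in affine opens. A closed point then has a finite orbit, contained in an
affine open; that open has finitely many translates, and their intersection is affine because V is
separated. Hence stable affine opens cover V. On each of them Galois descent for algebras
(`isPushout_invariants`) identifies Spec of the invariant sections as a k-form. The fibres of the
quotient maps are orbits, so these forms glue along open immersions, and the result is algebraic
because finite type and separatedness descend.

The criterion holds in case (a) by homogeneous prime avoidance. In case (b), over an algebraic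
closure, a group element moves the given points into a dense affine open, whose inverse image under
that translation is affine. Affine opens found over a normal extension are brought down to V by
intersecting translates again; this finishes (b) and gives (c). Case (d) reduces to (c), since Ωˢᵉᵖ
is then algebraically closed. -/

namespace FieldDescent

/-! ### Galois descent for algebras. -/

section GaloisDescent

open Module

/-- Dual bases for the trace form expand each e as ∑ Tr(bⱼ* e) bⱼ. Writing the trace as a sum over
automorphisms turns this into a linear relation among automorphisms, and Dedekind independence
determines its coefficients. -/
lemma sum_basis_mul_traceDual {k L : Type*} [Field k] [Field L] [Algebra k L]
    [FiniteDimensional k L] [IsGalois k L] {ι : Type*} [Fintype ι] [DecidableEq ι]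
    [DecidableEq (L ≃ₐ[k] L)] (b : Basis ι k L) (τ : L ≃ₐ[k] L) :
    ∑ j, b j * τ (b.traceDual j) = if τ = 1 then 1 else 0 := by
  have hli := (linearIndependent_toLinearMap k L L).comp
    (fun τ : L ≃ₐ[k] L => (τ : L →ₐ[k] L)) (fun σ τ h => by
      ext x; exact DFunLike.congr_fun h x)
  rw [Fintype.linearIndependent_iff] at hli
  have := hli (fun τ => (∑ j, b j * τ (b.traceDual j)) - if τ = 1 then 1 else 0) (by
    ext e
    simp only [Function.comp_apply, LinearMap.sum_apply, LinearMap.smul_apply, smul_eq_mul,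
      sub_mul, Finset.sum_sub_distrib, LinearMap.zero_apply]
    have h1 : ∑ τ : L ≃ₐ[k] L, (∑ j, b j * τ (b.traceDual j)) * τ e = e := by
      calc _ = ∑ j, b j * ∑ τ : L ≃ₐ[k] L, τ (b.traceDual j * e) := by
            simp only [Finset.sum_mul, Finset.mul_sum, map_mul]
            rw [Finset.sum_comm]
            simp only [mul_assoc]
        _ = ∑ j, (Algebra.trace k L (b.traceDual j * e)) • b j := by
            refine Finset.sum_congr rfl fun j _ => ?_
            rw [← trace_eq_sum_automorphisms, Algebra.smul_def, mul_comm]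
        _ = e := by
            conv_rhs => rw [← b.sum_repr e]
            refine Finset.sum_congr rfl fun j _ => ?_
            have := b.traceDual.traceDual_repr_apply e j
            rw [Basis.traceDual_traceDual, Algebra.traceForm_apply] at this
            rw [this, mul_comm]
    simpa [sub_eq_zero] using h1) τ
  exact sub_eq_zero.mp this

lemma apply_algebraMap_mul_of_restrictNormal {k Ω A : Type*} [Field k] [Field Ω]
    [Algebra k Ω] [CommRing A] [Algebra Ω A] (α : (Ω ≃ₐ[k] Ω) →* (A →+* A)) {L : IntermediateField k Ω} [Normal k L]
    (σ : Ω ≃ₐ[k] Ω) (e : L) (a : A) (hα : ∀ σ ω, α σ (algebraMap Ω A ω) = algebraMap Ω A (σ ω)) :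
    α σ (algebraMap Ω A e * a) =
      algebraMap Ω A (AlgEquiv.restrictNormalHom L σ e : L) * α σ a := by
  rw [map_mul, hα]
  congr 2
  exact (AlgEquiv.restrictNormal_commutes σ L e).symm

variable {k Ω A : Type*} [Field k] [Field Ω] [Algebra k Ω] [CommRing A] [Algebra Ω A]
  [Algebra k A] [IsScalarTower k Ω A]

/-- The invariants of a semilinear action of `Aut(Ω/k)` on an `Ω`-algebra. -/
def invariants (α : (Ω ≃ₐ[k] Ω) →* (A →+* A))
    (hα : ∀ σ ω, α σ (algebraMap Ω A ω) = algebraMap Ω A (σ ω)) : Subalgebra k A where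
  carrier := {a | ∀ σ, α σ a = a}
  mul_mem' ha hb σ := by rw [map_mul, ha, hb]
  add_mem' ha hb σ := by rw [map_add, ha, hb]
  algebraMap_mem' r σ := by
    rw [IsScalarTower.algebraMap_apply k Ω A, hα, AlgEquiv.commutes]

variable (α : (Ω ≃ₐ[k] Ω) →* (A →+* A))
  (hα : ∀ σ ω, α σ (algebraMap Ω A ω) = algebraMap Ω A (σ ω))

/-- This is a trace: σ · t τ and the chosen lift of σ|L · τ differ by an automorphism fixing L,
which fixes a, so σ only permutes the summands. -/
lemma sum_mem_invariants (L : IntermediateField k Ω) [FiniteDimensional k L] [Normal k L]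
    [Normal k Ω] (t : (L ≃ₐ[k] L) → (Ω ≃ₐ[k] Ω))
    (ht : ∀ τ, AlgEquiv.restrictNormalHom L (t τ) = τ) {a : A}
    (ha : ∀ σ : Ω ≃ₐ[k] Ω, (∀ x ∈ L, σ x = x) → α σ a = a) :
    ∑ τ, α (t τ) a ∈ invariants α hα := by
  intro σ
  rw [map_sum]
  refine Fintype.sum_equiv (Equiv.mulLeft (AlgEquiv.restrictNormalHom L σ)) _ _ fun τ => ?_
  have : σ * t τ = t (AlgEquiv.restrictNormalHom L σ * τ) *
      ((t (AlgEquiv.restrictNormalHom L σ * τ))⁻¹ * (σ * t τ)) := by group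
  rw [Equiv.coe_mulLeft, ← Function.comp_apply (f := α σ), ← RingHom.coe_comp, ← RingHom.mul_def,
    ← map_mul, this, map_mul, RingHom.mul_def, RingHom.comp_apply, ha]
  intro x hx
  have h1 : AlgEquiv.restrictNormalHom L
      ((t (AlgEquiv.restrictNormalHom L σ * τ))⁻¹ * (σ * t τ)) = 1 := by
    simp [map_mul, map_inv, ht, mul_assoc]
  have h2 := AlgEquiv.restrictNormal_commutes
    ((t (AlgEquiv.restrictNormalHom L σ * τ))⁻¹ * (σ * t τ)) L ⟨x, hx⟩
  rw [show AlgEquiv.restrictNormal _ L = 1 from h1] at h2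
  exact h2.symm

variable [IsGalois k Ω]

/-- The coefficients of a relation lie in a finite Galois L. Multiplying the relation by e ∈ L and
summing over lifts of Gal(L/k) gives a relation over k with coefficients Tr(e cᵢ). These vanish for
every e, and nondegeneracy of the trace form gives cᵢ = 0. -/
lemma linearIndependent_invariants {ι : Type*} {v : ι → invariants α hα}
    (hv : LinearIndependent k v) : LinearIndependent Ω (fun i => (v i : A)) := by
  classical
  rw [linearIndependent_iff']
  intro s c hc i hi
  let L := FiniteGaloisIntermediateField.adjoin k (s.image c : Set Ω)
  have hcL (i) (hi : i ∈ s) : c i ∈ L.toIntermediateField :=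
    FiniteGaloisIntermediateField.subset_adjoin k (s.image c : Set Ω)
      (by simpa using ⟨i, hi, rfl⟩)
  let c' (i : ι) : L.toIntermediateField := if h : i ∈ s then ⟨c i, hcL i h⟩ else 0
  have hc' (i) (hi : i ∈ s) : (c' i : Ω) = c i := by simp [c', hi]
  let t := Function.surjInv (AlgEquiv.restrictNormalHom_surjective (F := k)
    (K₁ := L.toIntermediateField) Ω)
  have ht (τ) : AlgEquiv.restrictNormalHom L.toIntermediateField (t τ) = τ :=
    Function.surjInv_eq _ τ
  have key (e : L.toIntermediateField) :
      ∑ i ∈ s, Algebra.trace k L.toIntermediateField (e * c' i) • v i = 0 := by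
    have h0 : ∑ τ, α (t τ) (algebraMap Ω A e * ∑ i ∈ s, c i • (v i : A)) = 0 := by simp [hc]
    refine Subtype.ext (Eq.trans ?_ h0)
    have h1 (τ) (i) (hi : i ∈ s) :
        α (t τ) (algebraMap Ω A e * (c i • (v i : A))) =
          algebraMap Ω A (τ (e * c' i) : L.toIntermediateField) * v i := by
      rw [← hc' i hi, Algebra.smul_def, ← mul_assoc, ← map_mul]
      refine (apply_algebraMap_mul_of_restrictNormal α (t τ) (e * c' i) (v i : A) hα).trans ?_
      rw [ht, (v i).2]
    simp only [Finset.mul_sum, map_sum]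
    rw [Finset.sum_comm, AddSubmonoidClass.coe_finsetSum]
    refine Finset.sum_congr rfl fun i hi => ?_
    rw [Finset.sum_congr rfl fun τ _ => h1 τ i hi, ← Finset.sum_mul, ← map_sum,
      ← AddSubmonoidClass.coe_finsetSum, ← trace_eq_sum_automorphisms]
    rw [SetLike.val_smul, Algebra.smul_def, IsScalarTower.algebraMap_apply k Ω A]
    rfl
  have h2 : c' i = 0 := by
    apply (traceForm_nondegenerate k L.toIntermediateField).1
    intro e
    rw [Algebra.traceForm_apply, mul_comm]
    exact linearIndependent_iff'.mp hv s _ (key e) i hi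
  rw [← hc' i hi, h2]; rfl

/-- With bⱼ, bⱼ* dual bases of a finite Galois L containing s, one has a = ∑ⱼ bⱼ ∑_τ τ(bⱼ* a), and
the inner sums are invariant. -/
lemma exists_sum_smul_invariants {a : A}
    (ha : ∃ s : Set Ω, s.Finite ∧ ∀ σ : Ω ≃ₐ[k] Ω, (∀ x ∈ s, σ x = x) → α σ a = a) :
    a ∈ Submodule.span Ω (invariants α hα : Set A) := by
  classical
  obtain ⟨s, hs, ha⟩ := ha
  have := hs.to_subtype
  let L := FiniteGaloisIntermediateField.adjoin k s
  have hsL := FiniteGaloisIntermediateField.subset_adjoin k s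
  let t := Function.surjInv (AlgEquiv.restrictNormalHom_surjective (F := k)
    (K₁ := L.toIntermediateField) Ω)
  have ht (τ) : AlgEquiv.restrictNormalHom L.toIntermediateField (t τ) = τ :=
    Function.surjInv_eq _ τ
  let b := finBasis k L.toIntermediateField
  have h1 : ∑ j, (b j : Ω) •
      ∑ τ, α (t τ) (algebraMap Ω A (b.traceDual j : L.toIntermediateField) * a) = a := by
    calc _ = ∑ τ, algebraMap Ω A
          ((∑ j, b j * τ (b.traceDual j) : L.toIntermediateField) : Ω) * α (t τ) a := by
          simp only [Finset.smul_sum]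
          rw [Finset.sum_comm]
          refine Finset.sum_congr rfl fun τ _ => ?_
          rw [AddSubmonoidClass.coe_finsetSum, map_sum, Finset.sum_mul]
          refine Finset.sum_congr rfl fun j _ => ?_
          rw [apply_algebraMap_mul_of_restrictNormal α _ _ _ hα, ht, MulMemClass.coe_mul, map_mul,
            Algebra.smul_def, mul_assoc]
      _ = α (t 1) a := by
          simp only [sum_basis_mul_traceDual]
          rw [Finset.sum_eq_single 1]
          · simp
          · intro τ _ h; simp [h]
          · simp
      _ = a := by
          refine ha _ fun x hx => ?_
          have h2 := AlgEquiv.restrictNormal_commutes (t 1) L.toIntermediateField ⟨x, hsL hx⟩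
          rw [show AlgEquiv.restrictNormal _ L.toIntermediateField = 1 from ht 1] at h2
          exact h2.symm
  rw [← h1]
  refine Submodule.sum_mem _ fun j _ => Submodule.smul_mem _ _ (Submodule.subset_span ?_)
  refine sum_mem_invariants α hα L.toIntermediateField t ht fun σ hσ => ?_
  rw [map_mul, hα, hσ _ (SetLike.coe_mem _), ha σ fun x hx => hσ x (hsL hx)]

/-- Galois descent for algebras with a continuous semilinear action. -/
theorem isPushout_invariants
    (hfin : ∀ a, ∃ s : Set Ω, s.Finite ∧ ∀ σ : Ω ≃ₐ[k] Ω, (∀ x ∈ s, σ x = x) → α σ a = a) :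
    Algebra.IsPushout k Ω (invariants α hα) A := by
  constructor
  let b := Basis.ofVectorSpace k (invariants α hα)
  -- A k-basis of the invariants is an Ω-basis of A.
  let B : Basis _ Ω A := Basis.mk (linearIndependent_invariants α hα b.linearIndependent) (by
    intro a _
    refine Submodule.span_le.mpr ?_ (exists_sum_smul_invariants α hα (hfin a))
    intro x hx
    have h := b.mem_span ⟨x, hx⟩
    have h' := Submodule.mem_map_of_mem (f := (invariants α hα).val.toLinearMap) h
    rw [Submodule.map_span, ← Set.range_comp] at h'
    exact Submodule.span_subset_span k Ω _ h')
  refine IsBaseChange.of_equiv ((Algebra.TensorProduct.basis Ω b).equiv B (Equiv.refl _)) ?_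
  intro x
  let f : invariants α hα →ₗ[k] A :=
    ((((Algebra.TensorProduct.basis Ω b).equiv B (Equiv.refl _)).toLinearMap.restrictScalars k).comp
      (TensorProduct.mk k Ω (invariants α hα) 1))
  suffices h : f = (IsScalarTower.toAlgHom k (invariants α hα) A).toLinearMap from
    LinearMap.congr_fun h x
  refine b.ext fun i => ?_
  have : (1 : Ω) ⊗ₜ[k] b i = Algebra.TensorProduct.basis Ω b i := by simp
  simp only [f, LinearMap.comp_apply, TensorProduct.mk_apply, this, LinearMap.restrictScalars_apply,
    LinearEquiv.coe_coe, Basis.equiv_apply]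
  simp [B]

end GaloisDescent

/-! ### Automorphisms of normal extensions and finite orbits. -/

lemma specMap_comp {F L M : Type u} [Field F] [Field L] [Field M] (i : F →+* L) (j : L →+* M) :
    specMap (j.comp i) = specMap j ≫ specMap i := by
  rw [← Spec.map_comp]; rfl

/-- Two embeddings of a normal extension differ by an automorphism. -/
lemma exists_algEquiv_of_algHom {K E F : Type*} [Field K] [Field E] [Field F] [Algebra K E]
    [Algebra K F] [Normal K E] (f g : E →ₐ[K] F) : ∃ σ : E ≃ₐ[K] E, ∀ x, g x = f (σ x) := by
  let _ := f.toRingHom.toAlgebra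
  have : IsScalarTower K E F := IsScalarTower.of_algebraMap_eq fun x => (f.commutes x).symm
  refine ⟨Normal.algHomEquivAut K F E g, fun x => ?_⟩
  have := (Normal.algHomEquivAut K F E).symm_apply_apply g
  conv_lhs => rw [← this]
  rfl

/-- The orbit of an element with open stabilizer is finite. -/
lemma finite_range_of_fixes {K E Z : Type*} [Field K] [Field E] [Algebra K E]
    [Algebra.IsAlgebraic K E] {s : Set E} (hs : s.Finite) (φ : (E ≃ₐ[K] E) → Z)
    (hφ : ∀ σ τ : E ≃ₐ[K] E, (∀ x ∈ s, σ x = τ x) → φ σ = φ τ) : (Set.range φ).Finite := by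
  have := hs.to_subtype
  -- The images of the elements of s are roots of their minimal polynomials, so only finitely many
  -- restrictions to s occur.
  have hfin : (Set.range fun (σ : E ≃ₐ[K] E) (x : s) => σ x).Finite := by
    refine (Set.Finite.pi' (t := fun x : s => (minpoly K (x : E)).rootSet E)
      fun x => Polynomial.rootSet_finite _ _).subset ?_
    rintro _ ⟨σ, rfl⟩ x
    rw [Polynomial.mem_rootSet]
    refine ⟨minpoly.ne_zero (Algebra.IsIntegral.isIntegral (x : E)), ?_⟩
    exact (Polynomial.aeval_algHom_apply (σ : E →ₐ[K] E) (x : E) _).trans (by simp)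
  let r := fun (σ : E ≃ₐ[K] E) (x : s) => σ x
  have hfac : Function.FactorsThrough φ r := fun σ τ h =>
    hφ σ τ fun x hx => congr_fun h ⟨x, hx⟩
  have : Set.range φ ⊆ (fun z : Set.range r => φ z.2.choose) '' Set.univ := by
    rintro _ ⟨σ, rfl⟩
    exact ⟨⟨r σ, σ, rfl⟩, trivial, hfac (⟨σ, rfl⟩ : ∃ y, r y = r σ).choose_spec⟩
  have := hfin.to_subtype
  exact Set.Finite.subset (Set.toFinite _) ‹Set.range φ ⊆ _›

/-! ### The projection Y_E → Y for a field extension E/K. -/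

section Pullback

variable {K E : Type u} [Field K] [Field E] [Algebra K E] {X Y : Scheme.{u}} {q : X ⟶ Y}
  {f : X ⟶ Spec (CommRingCat.of E)} {y : Y ⟶ Spec (CommRingCat.of K)}
  (H : IsPullback q f y (specMap (algebraMap K E)))

include H

/-- For a normal extension `E/K`, the fibres of `Y_E ⟶ Y` are orbits of `Aut(E/K)`. -/
lemma exists_algEquiv_of_apply_eq [Normal K E] {u v : X} (huv : q u = q v) :
    ∃ σ : E ≃ₐ[K] E, ∀ ρ : X ⟶ X, ρ ≫ q = q → ρ ≫ f = f ≫ specMap (σ : E →+* E) → ρ u = v := by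
  -- The residue field of a point of X ×_Y X over (u, v) receives E in two ways that agree on K;
  -- normality makes them differ by some σ.
  obtain ⟨z, hz₁, hz₂⟩ := Scheme.Pullback.exists_preimage_pullback u v huv
  let T := pullback q q
  let F := T.residueField z
  let a : Spec F ⟶ X := T.fromSpecResidueField z ≫ pullback.fst q q
  let b : Spec F ⟶ X := T.fromSpecResidueField z ≫ pullback.snd q q
  let p : Spec F := IsLocalRing.closedPoint F
  have ha : a p = u := by
    rw [← hz₁, Scheme.Hom.comp_apply, Scheme.fromSpecResidueField_apply]
  have hb : b p = v := by
    rw [← hz₂, Scheme.Hom.comp_apply, Scheme.fromSpecResidueField_apply]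
  have hab : a ≫ q = b ≫ q := by simp [a, b, pullback.condition]
  obtain ⟨ga, hga⟩ := Spec.map_surjective (a ≫ f)
  obtain ⟨gb, hgb⟩ := Spec.map_surjective (b ≫ f)
  have hg : CommRingCat.ofHom (algebraMap K E) ≫ ga = CommRingCat.ofHom (algebraMap K E) ≫ gb := by
    apply Spec.map_injective
    rw [Spec.map_comp, Spec.map_comp, hga, hgb, Category.assoc, Category.assoc]
    change a ≫ f ≫ specMap _ = b ≫ f ≫ specMap _
    rw [← H.w, reassoc_of% hab]
  let _ : Algebra K F := (ga.hom.comp (algebraMap K E)).toAlgebra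
  let ga' : E →ₐ[K] F := { ga.hom with commutes' := fun _ => rfl }
  let gb' : E →ₐ[K] F :=
    { gb.hom with commutes' := fun r => (congr($(hg).hom r)).symm }
  obtain ⟨σ, hσ⟩ := exists_algEquiv_of_algHom ga' gb'
  refine ⟨σ, fun ρ h₁ h₂ => ?_⟩
  have hab' : a ≫ ρ = b := by
    apply H.hom_ext
    · rw [Category.assoc, h₁, hab]
    · rw [Category.assoc, h₂, ← Category.assoc, ← hga, ← hgb, ← Spec.map_comp]
      congr 1
      ext x
      exact (hσ x).symm
  rw [← ha, ← hb, ← hab']; simp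

/-- Sections of `Y_E` over the preimage of an affine open of `Y` are fixed by an open subgroup. -/
lemma exists_finite_fixes_section {V : Y.Opens} (hV : IsAffineOpen V) (a : Γ(X, q ⁻¹ᵁ V)) :
    ∃ s : Set E, s.Finite ∧ ∀ σ : E →+* E, (∀ x ∈ s, σ x = x) → ∀ ρ : X ⟶ X,
      (h : ρ ≫ q = q) → ρ ≫ f = f ≫ specMap σ →
        ρ.appLE (q ⁻¹ᵁ V) (q ⁻¹ᵁ V) (by rw [← Scheme.Hom.comp_preimage, h]) a = a := by
  -- Over an affine V the sections form the pushout, so they are generated as a ring by sections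
  -- from V, fixed by every ρ over Y, and by scalars from E.
  have hpo := (isIso_pushoutSection_iff (US := ⊤) (UT := ⊤) (UX := V) H le_top le_top
    (by simp)).mp (isIso_pushoutSection_of_isAffineOpen H (US := ⊤) (UT := ⊤) (UX := V)
      le_top le_top (UY := q ⁻¹ᵁ V) (by simp) (isAffineOpen_top _) (isAffineOpen_top _) hV)
  have hcl := CommRingCat.closure_range_union_range_eq_top_of_isPushout hpo
  have ha := hcl.ge (Subring.mem_top a)
  clear hpo hcl
  induction ha using Subring.closure_induction with
  | mem x hx =>
    rcases hx with ⟨b, rfl⟩ | ⟨e, rfl⟩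
    · refine ⟨∅, Set.finite_empty, fun σ _ ρ h _ => ?_⟩
      rw [← CommRingCat.comp_apply, Scheme.Hom.appLE_comp_appLE]
      simp only [h]
    · obtain ⟨e, rfl⟩ := (ConcreteCategory.bijective_of_isIso
        (Scheme.ΓSpecIso (CommRingCat.of E)).inv).2 e
      refine ⟨{e}, Set.finite_singleton e, fun σ hσ ρ h h' => ?_⟩
      rw [← CommRingCat.comp_apply, Scheme.Hom.appLE_comp_appLE]
      simp only [h']
      rw [Scheme.Hom.comp_appLE, CommRingCat.comp_apply]
      congr 1
      change ((Scheme.ΓSpecIso (CommRingCat.of E)).inv ≫ (specMap σ).appTop) e = _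
      rw [← Scheme.ΓSpecIso_inv_naturality]
      exact congr_arg (Scheme.ΓSpecIso (CommRingCat.of E)).inv (hσ e rfl)
  | zero => exact ⟨∅, Set.finite_empty, fun _ _ _ _ _ => map_zero _⟩
  | one => exact ⟨∅, Set.finite_empty, fun _ _ _ _ _ => map_one _⟩
  | add x y _ _ hx hy =>
    obtain ⟨s, hs, hx⟩ := hx
    obtain ⟨t, ht, hy⟩ := hy
    refine ⟨s ∪ t, hs.union ht, fun σ hσ ρ h h' => ?_⟩
    rw [map_add, hx σ (fun x hx => hσ x (.inl hx)) ρ h h', hy σ (fun x hx => hσ x (.inr hx)) ρ h h']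
  | mul x y _ _ hx hy =>
    obtain ⟨s, hs, hx⟩ := hx
    obtain ⟨t, ht, hy⟩ := hy
    refine ⟨s ∪ t, hs.union ht, fun σ hσ ρ h h' => ?_⟩
    rw [map_mul, hx σ (fun x hx => hσ x (.inl hx)) ρ h h', hy σ (fun x hx => hσ x (.inr hx)) ρ h h']
  | neg x _ hx =>
    obtain ⟨s, hs, hx⟩ := hx
    refine ⟨s, hs, fun σ hσ ρ h h' => ?_⟩
    rw [map_neg, hx σ hσ ρ h h']

/-- Quasi-compact opens of `Y_E` are fixed by an open subgroup. -/
lemma exists_finite_fixes_opens {U : X.Opens} (hU : IsCompact (U : Set X)) :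
    ∃ s : Set E, s.Finite ∧ ∀ σ : E →+* E, (∀ x ∈ s, σ x = x) → ∀ ρ : X ⟶ X,
      ρ ≫ q = q → ρ ≫ f = f ≫ specMap σ → ρ ⁻¹ᵁ U = U := by
  have hloc (x : X) (hx : x ∈ U) : ∃ D : X.Opens, x ∈ D ∧ D ≤ U ∧
      ∃ s : Set E, s.Finite ∧ ∀ σ : E →+* E, (∀ x ∈ s, σ x = x) → ∀ ρ : X ⟶ X,
      ρ ≫ q = q → ρ ≫ f = f ≫ specMap σ → ρ ⁻¹ᵁ D = D := by
    obtain ⟨_, ⟨V, hV, rfl⟩, hxV, -⟩ := Y.isBasis_affineOpens.exists_subset_of_mem_open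
      (Set.mem_univ (q x)) isOpen_univ
    have : IsAffineHom q := by
      have : IsAffineHom (specMap (algebraMap K E)) := inferInstance
      exact MorphismProperty.of_isPullback H.flip this
    have hqV : IsAffineOpen (q ⁻¹ᵁ V) := IsAffineOpen.preimage hV q
    -- A basic open is fixed as soon as the section defining it is; compactness of U leaves finitely
    -- many of them.
    obtain ⟨a, ha, hxa⟩ := hqV.exists_basicOpen_le ⟨x, hx⟩ hxV
    obtain ⟨s, hs, hfix⟩ := exists_finite_fixes_section H hV a
    refine ⟨X.basicOpen a, hxa, ha, s, hs, fun σ hσ ρ h h' => ?_⟩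
    have h1 := hfix σ hσ ρ h h'
    have h2 := Scheme.basicOpen_appLE ρ (q ⁻¹ᵁ V) (q ⁻¹ᵁ V)
      (by rw [← Scheme.Hom.comp_preimage, h]) a
    rw [h1] at h2
    conv_rhs => rw [h2]
    rw [right_eq_inf]
    exact (ρ.preimage_mono (X.basicOpen_le a)).trans (by rw [← Scheme.Hom.comp_preimage, h])
  choose! D hxD hDU s hs hfix using hloc
  obtain ⟨t, ht⟩ := hU.elim_nhds_subcover' (fun x _ => (D x : Set X))
    fun x hx => (D x).isOpen.mem_nhds (hxD x hx)
  refine ⟨⋃ x ∈ t, s x, t.finite_toSet.biUnion fun x _ => hs x x.2, fun σ hσ ρ h h' => ?_⟩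
  have hUt : U = ⨆ x ∈ t, D x := by
    apply le_antisymm
    · intro x hx
      have := ht hx
      simp only [Set.mem_iUnion] at this
      obtain ⟨z, hz, hxz⟩ := this
      simp only [TopologicalSpace.Opens.mem_iSup]
      exact ⟨z, hz, hxz⟩
    · exact iSup₂_le fun x _ => hDU x x.2
  rw [hUt]
  ext x
  simp only [TopologicalSpace.Opens.coe_iSup, Scheme.Hom.preimage_iSup, Set.mem_iUnion]
  refine exists_congr fun z => exists_congr fun hz => ?_
  rw [hfix z z.2 σ (fun x hx => hσ x (by simp only [Set.mem_iUnion]; exact ⟨z, hz, hx⟩)) ρ h h']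

/-- A quasi-separated scheme is affine if it becomes affine over an extension field. -/
lemma isAffine_of_isPullback_specMap [IsAffine X] [QuasiSeparatedSpace Y] : IsAffine Y := by
  have hq : Surjective q := MorphismProperty.of_isPullback H.flip
    (inferInstanceAs (Surjective (specMap (algebraMap K E))))
  have : CompactSpace Y := ⟨by
    rw [← hq.surj.range_eq]; exact isCompact_range q.continuous⟩
  -- Flat base change gives Γ(X) = Γ(Y) ⊗ E. Hence `X.toSpecΓ` is the base change of `Y.toSpecΓ`
  -- along a faithfully flat quasi-compact map, and being an isomorphism descends.
  have hpo := (isIso_pushoutSection_iff (US := ⊤) (UT := ⊤) (UX := ⊤) H le_top le_top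
    (UY := ⊤) (by simp)).mp (isIso_pushoutSection_of_isQuasiSeparated_of_flat_right H (US := ⊤)
      (UT := ⊤) (UX := ⊤) le_top le_top (UY := ⊤) (by simp) (isAffineOpen_top _)
      (isAffineOpen_top _) isCompact_univ isQuasiSeparated_univ)
  have htop {S T : Scheme.{u}} (g : S ⟶ T) : g.appLE ⊤ ⊤ le_top = g.appTop :=
    Scheme.Hom.appLE_eq_app g
  rw [htop, htop, htop, htop] at hpo
  have h₁ := isPullback_SpecMap_of_isPushout _ _ _ _ hpo
  have h₂ : IsPullback q (f ≫ (Spec (CommRingCat.of E)).toSpecΓ)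
      (y ≫ (Spec (CommRingCat.of K)).toSpecΓ) (Spec.map (specMap (algebraMap K E)).appTop) := by
    refine H.paste_vert (IsPullback.of_vert_isIso ⟨?_⟩)
    exact Scheme.toSpecΓ_naturality _
  rw [Scheme.toSpecΓ_naturality, Scheme.toSpecΓ_naturality] at h₂
  have h₃ : IsPullback q X.toSpecΓ Y.toSpecΓ (Spec.map q.appTop) :=
    IsPullback.of_bot h₂ (Scheme.toSpecΓ_naturality q) h₁
  have hfl : (@Surjective ⊓ @Flat ⊓ @QuasiCompact : MorphismProperty Scheme.{u})
      (Spec.map q.appTop) := by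
    have h : (@Surjective ⊓ @Flat ⊓ @QuasiCompact : MorphismProperty Scheme.{u})
        (Spec.map (specMap (algebraMap K E)).appTop) := by
      have : Nonempty (Spec Γ(Spec (CommRingCat.of E), ⊤)) :=
        ⟨(Spec (CommRingCat.of E)).toSpecΓ (IsLocalRing.closedPoint E)⟩
      have h1 : IsIso (Spec (CommRingCat.of K)).toSpecΓ := inferInstance
      have h2 : Spec.map (specMap (algebraMap K E)).appTop =
          inv (Spec (CommRingCat.of E)).toSpecΓ ≫ specMap (algebraMap K E) ≫
            (Spec (CommRingCat.of K)).toSpecΓ := by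
        rw [Scheme.toSpecΓ_naturality, IsIso.inv_hom_id_assoc]
      rw [h2]
      exact ⟨⟨inferInstance, inferInstance⟩, inferInstance⟩
    exact ⟨⟨MorphismProperty.of_isPullback (P := @Surjective) h₁.flip h.1.1,
      MorphismProperty.of_isPullback (P := @Flat) h₁.flip h.1.2⟩,
      MorphismProperty.of_isPullback (P := @QuasiCompact) h₁.flip h.2⟩
  exact ⟨MorphismProperty.of_isPullback_of_descendsAlong
    (P := MorphismProperty.isomorphisms Scheme.{u}) h₃.flip hfl
    (inferInstanceAs (IsIso X.toSpecΓ))⟩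

/-- For a normal extension `E/K`, an affine open of `Y_E` stable under `Aut(E/K)` descends to an
affine open of `Y`. -/
lemma exists_isAffineOpen_preimage_eq [Normal K E] [QuasiSeparatedSpace Y] {W : X.Opens}
    (hW : IsAffineOpen W) (hst : ∀ σ : E ≃ₐ[K] E, ∃ ρ : X ⟶ X, ρ ≫ q = q ∧
      ρ ≫ f = f ≫ specMap (σ : E →+* E) ∧ ρ ⁻¹ᵁ W = W) :
    ∃ W₁ : Y.Opens, IsAffineOpen W₁ ∧ q ⁻¹ᵁ W₁ = W := by
  have hq : UniversallyOpen q := MorphismProperty.of_isPullback H.flip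
    (inferInstanceAs (UniversallyOpen (specMap (algebraMap K E))))
  let W₁ : Y.Opens := ⟨q '' W, q.isOpenMap _ W.isOpen⟩
  have hpre : q ⁻¹ᵁ W₁ = W := by
    ext u
    refine ⟨?_, fun hu => ⟨u, hu, rfl⟩⟩
    rintro ⟨w, hw, hwu⟩
    -- Fibres are orbits, so a stable open is saturated for q.
    obtain ⟨σ, hσ⟩ := exists_algEquiv_of_apply_eq H hwu.symm
    obtain ⟨ρ, h₁, h₂, h₃⟩ := hst σ
    have : u ∈ ρ ⁻¹ᵁ W := by
      change ρ u ∈ W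
      rwa [hσ ρ h₁ h₂]
    rwa [h₃] at this
  refine ⟨W₁, ?_, hpre⟩
  have h₁ := (isPullback_morphismRestrict q W₁).paste_vert H
  have : IsAffine (q ⁻¹ᵁ W₁) := by rw [hpre]; exact hW
  have : QuasiSeparatedSpace W₁ := .of_isOpenEmbedding W₁.ι.isOpenEmbedding
  exact isAffine_of_isPullback_specMap h₁

end Pullback

/-- The categorical form of Galois descent for algebras. -/
lemma isPushout_invariant_subring {k Ω : Type u} [Field k] [Field Ω] [Algebra k Ω] [IsGalois k Ω]
    {A : CommRingCat.{u}} (i : CommRingCat.of Ω ⟶ A) (α : (Ω ≃ₐ[k] Ω) →* (A →+* A))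
    (hα : ∀ σ ω, α σ (i ω) = i (σ ω)) (A₀ : Subring A) (hA₀ : ∀ a, a ∈ A₀ ↔ ∀ σ, α σ a = a)
    (j : CommRingCat.of k ⟶ CommRingCat.of A₀)
    (hj : j ≫ CommRingCat.ofHom A₀.subtype = CommRingCat.ofHom (algebraMap k Ω) ≫ i)
    (hfin : ∀ a, ∃ s : Set Ω, s.Finite ∧ ∀ σ : Ω ≃ₐ[k] Ω, (∀ x ∈ s, σ x = x) → α σ a = a) :
    IsPushout (CommRingCat.ofHom (algebraMap k Ω)) j i (CommRingCat.ofHom A₀.subtype) := by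
  let _ : Algebra Ω A := i.hom.toAlgebra
  let _ : Algebra k A := (i.hom.comp (algebraMap k Ω)).toAlgebra
  have : IsScalarTower k Ω A := IsScalarTower.of_algebraMap_eq fun _ => rfl
  obtain rfl : A₀ = (invariants α hα).toSubring := by
    ext a; exact hA₀ a
  have hp := isPushout_invariants α hα hfin
  have h := CommRingCat.isPushout_of_isPushout k Ω (invariants α hα) A
  have hj' : j = CommRingCat.ofHom (algebraMap k (invariants α hα)) := by
    refine CommRingCat.hom_ext (RingHom.ext fun x => ?_)
    have h : (invariants α hα).toSubring.subtype (j.hom x) = i (algebraMap k Ω x) :=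
      DFunLike.congr_fun (congrArg CommRingCat.Hom.hom hj) x
    exact Subtype.val_injective h
  rw [hj']
  exact h

/-- A semilinear action of `Aut(Ω/k)` on an `Ω`-scheme. -/
structure SemilinearAction (k : Type u) {Ω : Type u} [Field k] [Field Ω] [Algebra k Ω]
    {X : Scheme.{u}} (f : X ⟶ Spec (CommRingCat.of Ω)) where
  ρ : (Ω ≃ₐ[k] Ω) → (X ⟶ X)
  comm (σ : Ω ≃ₐ[k] Ω) : ρ σ ≫ f = f ≫ specMap (σ : Ω →+* Ω)
  map_one : ρ 1 = 𝟙 X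
  map_mul (σ τ : Ω ≃ₐ[k] Ω) : ρ (σ * τ) = ρ σ ≫ ρ τ

/-! ### Continuity of semilinear actions and stable affine opens. -/

namespace SemilinearAction

variable {k Ω : Type u} [Field k] [Field Ω] [Algebra k Ω] {X : Scheme.{u}}
  {f : X ⟶ Spec (CommRingCat.of Ω)} (S : SemilinearAction k f)

@[simp]
lemma ρ_comp_inv (σ : Ω ≃ₐ[k] Ω) : S.ρ σ ≫ S.ρ σ⁻¹ = 𝟙 X := by
  rw [← S.map_mul, mul_inv_cancel, S.map_one]

@[simp]
lemma ρ_inv_comp (σ : Ω ≃ₐ[k] Ω) : S.ρ σ⁻¹ ≫ S.ρ σ = 𝟙 X := by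
  rw [← S.map_mul, inv_mul_cancel, S.map_one]

instance (σ : Ω ≃ₐ[k] Ω) : IsIso (S.ρ σ) := ⟨S.ρ σ⁻¹, by simp, by simp⟩

/-- On points the action is a right action, because Spec is contravariant. -/
lemma ρ_mul_apply (σ τ : Ω ≃ₐ[k] Ω) (x : X) : S.ρ (σ * τ) x = S.ρ τ (S.ρ σ x) := by
  rw [S.map_mul, Scheme.Hom.comp_apply]

/-- An open is stable if it is its own preimage under all `ρ σ`. -/
def IsStable (W : X.Opens) : Prop := ∀ σ, S.ρ σ ⁻¹ᵁ W = W

variable {S} in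
lemma IsStable.le {W : X.Opens} (h : S.IsStable W) (σ : Ω ≃ₐ[k] Ω) : W ≤ S.ρ σ ⁻¹ᵁ W := (h σ).ge

variable {S} in
lemma IsStable.inf {W W' : X.Opens} (h : S.IsStable W) (h' : S.IsStable W') :
    S.IsStable (W ⊓ W') := fun σ => by
  rw [Scheme.Hom.preimage_inf, h σ, h' σ]

/-- Every quasi-compact open has a finite orbit. -/
def HasFiniteOrbits : Prop :=
  ∀ U : X.Opens, IsCompact (U : Set X) → (Set.range fun σ => S.ρ σ ⁻¹ᵁ U).Finite

/-- The sections over a stable affine open are fixed by open subgroups. -/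
def HasContinuousSections : Prop :=
  ∀ (W : X.Opens) (_ : IsAffineOpen W) (h : S.IsStable W) (a : Γ(X, W)),
    ∃ s : Set Ω, s.Finite ∧ ∀ σ : Ω ≃ₐ[k] Ω, (∀ x ∈ s, σ x = x) →
      (S.ρ σ).appLE W W (h.le σ) a = a

section Continuity

variable {K : Type u} [Field K] [Algebra K Ω] {Y : Scheme.{u}} {q : X ⟶ Y}
  {y : Y ⟶ Spec (CommRingCat.of K)} (H : IsPullback q f y (specMap (algebraMap K Ω)))
  {t : Set Ω} (ht : t.Finite) (hq : ∀ σ : Ω ≃ₐ[k] Ω, (∀ x ∈ t, σ x = x) → S.ρ σ ≫ q = q)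

include H ht hq

/-- A quasi-compact U is fixed by every automorphism fixing a suitable finite set pointwise, so its
translate by σ depends only on finitely many values of σ. -/
lemma hasFiniteOrbits_of_isPullback [Algebra.IsAlgebraic k Ω] : S.HasFiniteOrbits := by
  intro U hU
  obtain ⟨s, hs, hfix⟩ := exists_finite_fixes_opens H hU
  refine finite_range_of_fixes (hs.union ht) _ fun σ τ hστ => ?_
  have h1 (x) (hx : x ∈ s ∪ t) : (σ⁻¹ * τ) x = x := by
    rw [AlgEquiv.mul_apply, ← hστ x hx]
    exact σ.symm_apply_apply x
  have h2 := hfix ((σ⁻¹ * τ : Ω ≃ₐ[k] Ω) : Ω →+* Ω) (fun x hx => h1 x (.inl hx)) _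
    (hq _ fun x hx => h1 x (.inr hx)) (S.comm _)
  have h3 : S.ρ τ = S.ρ σ ≫ S.ρ (σ⁻¹ * τ) := by rw [← S.map_mul]; simp
  rw [h3, Scheme.Hom.comp_preimage, h2]

/-- Stability under Aut(Ω/K) makes W the preimage of an affine open of Y, where continuity of
sections is already known. -/
lemma hasContinuousSections_of_isPullback [Algebra k K] [IsScalarTower k K Ω] [Normal K Ω]
    [QuasiSeparatedSpace Y] (htK : ∀ x ∈ t, x ∈ Set.range (algebraMap K Ω)) :
    S.HasContinuousSections := by
  intro W hW hst a
  obtain ⟨W₁, hW₁, rfl⟩ := exists_isAffineOpen_preimage_eq H hW fun σ =>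
    ⟨S.ρ (σ.restrictScalars k), hq _ fun x hx => by
      obtain ⟨x, rfl⟩ := htK x hx
      exact σ.commutes x, S.comm _, hst _⟩
  obtain ⟨s, hs, hfix⟩ := exists_finite_fixes_section H hW₁ a
  refine ⟨s ∪ t, hs.union ht, fun σ hσ => ?_⟩
  exact hfix (σ : Ω →+* Ω) (fun x hx => hσ x (.inl hx)) _ (hq σ fun x hx => hσ x (.inr hx))
    (S.comm σ)

end Continuity

/-- A finite set of closed points is contained in a stable affine open if the orbits are finite
and every finite set of closed points is contained in an affine open. -/
lemma exists_isStable_isAffineOpen [X.IsSeparated] [TopologicalSpace.NoetherianSpace X]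
    (hS : S.HasFiniteOrbits) (hX : FiniteClosedSetsInAffine X) {Z : Set X} (hZ : Z.Finite)
    (hZc : ∀ z ∈ Z, IsClosed {z}) :
    ∃ W : X.Opens, IsAffineOpen W ∧ S.IsStable W ∧ Z ⊆ W := by
  have hsing (σ : Ω ≃ₐ[k] Ω) (z : X) : S.ρ σ⁻¹ ⁻¹' {z} = {S.ρ σ z} := by
    ext x
    simp only [Set.mem_preimage, Set.mem_singleton_iff]
    constructor
    · rintro rfl
      rw [← Scheme.Hom.comp_apply, S.ρ_inv_comp]; rfl
    · rintro rfl
      rw [← Scheme.Hom.comp_apply, S.ρ_comp_inv]; rfl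
  have hfin : (⋃ z ∈ Z, Set.range fun σ => S.ρ σ z).Finite := by
    refine hZ.biUnion fun z hz => ?_
    -- The orbit of z is read off from the orbit of its open complement, which is quasi-compact
    -- because X is Noetherian.
    let U : X.Opens := ⟨{z}ᶜ, (hZc z hz).isOpen_compl⟩
    have h1 := hS U (TopologicalSpace.NoetherianSpace.isCompact _)
    refine Set.Finite.of_finite_image (f := fun x => ({x} : Set X)) ?_
      Set.singleton_injective.injOn
    refine (h1.image fun U : X.Opens => (U : Set X)ᶜ).subset ?_
    rintro _ ⟨_, ⟨σ, rfl⟩, rfl⟩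
    refine ⟨_, ⟨σ⁻¹, rfl⟩, ?_⟩
    change (S.ρ σ⁻¹ ⁻¹' {z}ᶜ)ᶜ = {S.ρ σ z}
    rw [Set.preimage_compl, compl_compl, hsing]
  obtain ⟨U, hU, hZU⟩ := hX _ hfin (by
    simp only [Set.mem_iUnion, Set.mem_range]
    rintro _ ⟨z, hz, σ, rfl⟩
    rw [← hsing]
    exact (hZc z hz).preimage (S.ρ σ⁻¹).continuous)
  have hUfin := hS U hU.isCompact
  have := hUfin.to_subtype
  -- The intersection runs over the set of distinct translates, which is finite, so separatedness
  -- keeps it affine.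
  let W : X.Opens := ⨅ V : Set.range fun σ => S.ρ σ ⁻¹ᵁ U, (V : X.Opens)
  have hW (x : X) : x ∈ W ↔ ∀ σ, S.ρ σ x ∈ U := by
    rw [← SetLike.mem_coe, TopologicalSpace.Opens.coe_iInf]
    simp
  have : Nonempty (Set.range fun σ => S.ρ σ ⁻¹ᵁ U) := ⟨⟨_, 1, rfl⟩⟩
  refine ⟨W, IsAffineOpen.iInf ?_, fun τ => ?_, fun z hz => ?_⟩
  · rintro ⟨_, σ, rfl⟩
    exact hU.preimage _
  · ext x
    change S.ρ τ x ∈ W ↔ x ∈ W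
    rw [hW, hW]
    refine ⟨fun h σ => ?_, fun h σ => ?_⟩
    · have := h (τ⁻¹ * σ)
      rwa [← S.ρ_mul_apply, mul_inv_cancel_left] at this
    · rw [← S.ρ_mul_apply]; exact h _
  · exact (hW z).mpr fun σ => hZU (by simpa using ⟨z, hz, σ, rfl⟩)

end SemilinearAction

/-! ### Quotients of stable affine opens. -/

namespace SemilinearAction

/-- The scalars `Ω` as sections over an open. -/
def scalars {Ω : Type u} [Field Ω] {X : Scheme.{u}} (f : X ⟶ Spec (CommRingCat.of Ω)) (W : X.Opens) : CommRingCat.of Ω ⟶ Γ(X, W) :=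
  (Scheme.ΓSpecIso (CommRingCat.of Ω)).inv ≫ f.appLE ⊤ W (le_top.trans_eq f.preimage_top.symm)

lemma toSpecΓ_specMap_scalars {Ω : Type u} [Field Ω] {X : Scheme.{u}}
    (f : X ⟶ Spec (CommRingCat.of Ω)) (W : X.Opens) :
    W.toSpecΓ ≫ Spec.map (scalars f W) = W.ι ≫ f := by
  rw [scalars, Spec.map_comp, Scheme.Opens.toSpecΓ_SpecMap_appLE_assoc, Scheme.Opens.toSpecΓ_top,
    Category.assoc, Scheme.Hom.resLE_comp_ι_assoc]
  have : (Spec (CommRingCat.of Ω)).toSpecΓ ≫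
      Spec.map (Scheme.ΓSpecIso (CommRingCat.of Ω)).inv = 𝟙 _ := by
    simp
  rw [this, Category.comp_id]

variable {k Ω : Type u} [Field k] [Field Ω] [Algebra k Ω] {X : Scheme.{u}}
  {f : X ⟶ Spec (CommRingCat.of Ω)} (S : SemilinearAction k f)

/-- The stable affine opens. -/
structure StableAffine where
  opens : X.Opens
  isAffineOpen : IsAffineOpen opens
  isStable : S.IsStable opens

instance : Preorder S.StableAffine := Preorder.lift StableAffine.opens

/-- The invariant sections over a stable open. -/
def invariantSections {W : X.Opens} (h : S.IsStable W) : Subring Γ(X, W) where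
  carrier := {a | ∀ σ, (S.ρ σ).appLE W W (h.le σ) a = a}
  mul_mem' ha hb σ := by rw [RingHom.map_mul, ha, hb]
  add_mem' ha hb σ := by rw [RingHom.map_add, ha, hb]
  one_mem' σ := RingHom.map_one _
  zero_mem' σ := RingHom.map_zero _
  neg_mem' ha σ := by rw [RingHom.map_neg, ha]

lemma appLE_scalars {W : X.Opens} (h : S.IsStable W) (σ : Ω ≃ₐ[k] Ω) (ω : Ω) :
    (S.ρ σ).appLE W W (h.le σ) (scalars f W ω) = scalars f W (σ ω) := by
  have h1 : scalars f W ≫ (S.ρ σ).appLE W W (h.le σ) =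
      CommRingCat.ofHom (σ : Ω →+* Ω) ≫ scalars f W := by
    rw [scalars, Category.assoc, Scheme.Hom.appLE_comp_appLE]
    simp only [S.comm]
    rw [Scheme.Hom.comp_appLE, ← Category.assoc, ← Category.assoc,
      Scheme.ΓSpecIso_inv_naturality]
    rfl
  exact DFunLike.congr_fun (congrArg CommRingCat.Hom.hom h1) ω

/-- The action on the sections over a stable open. -/
def sectionsAction {W : X.Opens} (h : S.IsStable W) : (Ω ≃ₐ[k] Ω) →* (Γ(X, W) →+* Γ(X, W)) where
  toFun σ := ((S.ρ σ).appLE W W (h.le σ)).hom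
  map_one' := by
    simp only [S.map_one]
    ext a
    change X.presheaf.map (𝟙 _) a = a
    simp
  map_mul' σ τ := by
    simp only [S.map_mul]
    rw [← Scheme.Hom.appLE_comp_appLE (S.ρ σ) (S.ρ τ) W W W (h.le τ) (h.le σ)]
    rfl

/-- The scalars `k` as invariant sections. -/
def invariantScalars {W : X.Opens} (h : S.IsStable W) :
    CommRingCat.of k ⟶ CommRingCat.of (S.invariantSections h) :=
  CommRingCat.ofHom (((scalars f W).hom.comp (algebraMap k Ω)).codRestrict
    (S.invariantSections h) fun x σ => by
      rw [RingHom.comp_apply]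
      exact (S.appLE_scalars h σ _).trans (by rw [AlgEquiv.commutes]))

/-- Restriction of invariant sections. -/
def restrictInvariants {W W' : S.StableAffine} (h : W ≤ W') :
    CommRingCat.of (S.invariantSections W'.isStable) ⟶ CommRingCat.of (S.invariantSections W.isStable) :=
  CommRingCat.ofHom ((X.presheaf.map (homOfLE (show W.opens ≤ W'.opens from h)).op).hom.restrict
    (S.invariantSections W'.isStable) (S.invariantSections W.isStable) fun a ha σ => by
      rw [← CommRingCat.comp_apply, Scheme.Hom.map_appLE]
      have h1 := congrArg (X.presheaf.map (homOfLE (show W.opens ≤ W'.opens from h)).op) (ha σ)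
      rw [← CommRingCat.comp_apply, Scheme.Hom.appLE_map] at h1
      exact h1)

/-- The diagram of quotients of the stable affine opens. -/
def quotFunctor : S.StableAffine ⥤ Scheme.{u} where
  obj W := Spec (CommRingCat.of (S.invariantSections W.isStable))
  map h := Spec.map (S.restrictInvariants h.le)
  map_id W := by
    have : S.restrictInvariants (𝟙 W : W ⟶ W).le = 𝟙 _ := by
      refine CommRingCat.hom_ext (RingHom.ext fun a => Subtype.ext ?_)
      change X.presheaf.map (𝟙 _) a.1 = a.1
      simp
    rw [this, Spec.map_id]
  map_comp {W W' W''} h h' := by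
    rw [← Spec.map_comp]
    congr 1
    refine CommRingCat.hom_ext (RingHom.ext fun a => Subtype.ext ?_)
    change X.presheaf.map _ a.1 = X.presheaf.map _ (X.presheaf.map _ a.1)
    rw [← CommRingCat.comp_apply, ← Functor.map_comp]
    rfl

/-- The structure morphism of the quotient of a stable affine open. -/
def quotStr (W : S.StableAffine) : S.quotFunctor.obj W ⟶ Spec (CommRingCat.of k) :=
  Spec.map (S.invariantScalars W.isStable)

/-- The quotient morphism of a stable affine open. -/
def toQuot (W : S.StableAffine) : (W.opens : Scheme) ⟶ S.quotFunctor.obj W :=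
  W.opens.toSpecΓ ≫ Spec.map (CommRingCat.ofHom (S.invariantSections W.isStable).subtype)

lemma toQuot_naturality {W W' : S.StableAffine} (h : W ⟶ W') :
    S.toQuot W ≫ S.quotFunctor.map h = X.homOfLE h.le ≫ S.toQuot W' := by
  have h1 := Scheme.Opens.toSpecΓ_SpecMap_presheaf_map_assoc W.opens W'.opens h.le
    (Spec.map (CommRingCat.ofHom (S.invariantSections W'.isStable).subtype))
  refine .trans ?_ h1
  refine (Category.assoc _ _ _).trans (congrArg _ ?_)
  rw [← Spec.map_comp]
  refine (Spec.map_comp _ _).symm.trans (congrArg Spec.map ?_)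
  exact CommRingCat.hom_ext (RingHom.ext fun a => rfl)

lemma quotFunctor_map_quotStr {W W' : S.StableAffine} (h : W ⟶ W') :
    S.quotFunctor.map h ≫ S.quotStr W' = S.quotStr W := by
  refine (Spec.map_comp _ _).symm.trans (congrArg Spec.map ?_)
  refine CommRingCat.hom_ext (RingHom.ext fun a => Subtype.ext ?_)
  change (scalars f W'.opens ≫ X.presheaf.map _) (algebraMap k Ω a) = scalars f W.opens _
  rw [scalars, Category.assoc, Scheme.Hom.appLE_map]
  rfl

lemma resLE_toQuot (W : S.StableAffine) (σ : Ω ≃ₐ[k] Ω) :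
    (S.ρ σ).resLE W.opens W.opens (W.isStable.le σ) ≫ S.toQuot W = S.toQuot W := by
  refine (Scheme.Opens.toSpecΓ_SpecMap_appLE_assoc (S.ρ σ) W.opens W.opens (W.isStable.le σ)
    (Spec.map (CommRingCat.ofHom (S.invariantSections W.isStable).subtype))).symm.trans ?_
  refine congrArg _ ((Spec.map_comp _ _).symm.trans (congrArg Spec.map ?_))
  exact CommRingCat.hom_ext (RingHom.ext fun a => a.2 σ)

lemma resLE_comm (W : S.StableAffine) (σ : Ω ≃ₐ[k] Ω) :
    (S.ρ σ).resLE W.opens W.opens (W.isStable.le σ) ≫ W.opens.ι ≫ f =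
      (W.opens.ι ≫ f) ≫ specMap (σ : Ω →+* Ω) := by
  rw [Scheme.Hom.resLE_comp_ι_assoc, S.comm, Category.assoc]

variable [IsGalois k Ω]

/-- A stable affine open is the base change of its quotient. -/
lemma isPullback_toQuot (hc : S.HasContinuousSections) (W : S.StableAffine) :
    IsPullback (S.toQuot W) (W.opens.ι ≫ f) (S.quotStr W) (specMap (algebraMap k Ω)) := by
  have hpo := isPushout_invariant_subring (scalars f W.opens) (S.sectionsAction W.isStable)
    (S.appLE_scalars W.isStable) (S.invariantSections W.isStable) (fun a => Iff.rfl)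
    (S.invariantScalars W.isStable) rfl (hc W.opens W.isAffineOpen W.isStable)
  have h1 := (isPullback_SpecMap_of_isPushout _ _ _ _ hpo).flip
  have : IsIso W.opens.toSpecΓ := inferInstanceAs (IsIso W.isAffineOpen.isoSpec.hom)
  have h2 : IsPullback W.opens.toSpecΓ (W.opens.ι ≫ f) (Spec.map (scalars f W.opens)) (𝟙 _) :=
    IsPullback.of_horiz_isIso ⟨by rw [toSpecΓ_specMap_scalars, Category.comp_id]⟩
  have h3 := h2.paste_horiz h1
  rwa [Category.id_comp] at h3

end SemilinearAction

/-- A square over an open cover of the base is a pullback if it is so locally. -/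
lemma isPullback_of_openCover {X Y T Z : Scheme.{u}} {p : X ⟶ Y} {f : X ⟶ T} {y : Y ⟶ Z}
    {g : T ⟶ Z} (w : p ≫ y = f ≫ g) (𝒱 : Y.OpenCover) {U : 𝒱.I₀ → Scheme.{u}}
    (a : ∀ i, U i ⟶ 𝒱.X i) (b : ∀ i, U i ⟶ X) (h₁ : ∀ i, IsPullback (b i) (a i) p (𝒱.f i))
    (h₂ : ∀ i, IsPullback (a i) (b i ≫ f) (𝒱.f i ≫ y) g) : IsPullback p f y g := by
  let l : X ⟶ pullback y g := pullback.lift p f w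
  suffices IsIso l from
    IsPullback.of_iso_pullback ⟨w⟩ (asIso l) (pullback.lift_fst _ _ _) (pullback.lift_snd _ _ _)
  refine (IsZariskiLocalAtTarget.iff_of_openCover (P := MorphismProperty.isomorphisms Scheme)
    (𝒱.pullback₁ (pullback.fst y g))).mpr fun i => ?_
  let P := pullback (pullback.fst y g) (𝒱.f i)
  have hP : IsPullback (pullback.fst (pullback.fst y g) (𝒱.f i))
    (pullback.snd (pullback.fst y g) (𝒱.f i)) (pullback.fst y g) (𝒱.f i) := .of_hasPullback _ _
  -- Both ends of c are fibre products of 𝒱ᵢ and T over Z, so c is an isomorphism; it is also the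
  -- base change of l to the i-th member of the cover.
  let c : U i ⟶ P := pullback.lift (b i ≫ l) (a i) (by
    rw [Category.assoc, pullback.lift_fst, (h₁ i).w])
  have hP' : IsPullback (pullback.snd (pullback.fst y g) (𝒱.f i))
    (pullback.fst (pullback.fst y g) (𝒱.f i) ≫ pullback.snd y g) (𝒱.f i ≫ y) g :=
    hP.flip.paste_vert (.of_hasPullback y g)
  have hc : IsIso c := by
    have : c = ((h₂ i).isoIsPullback _ _ hP').hom := by
      refine hP'.hom_ext ?_ ?_
      · rw [IsPullback.isoIsPullback_hom_fst, pullback.lift_snd]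
      · rw [IsPullback.isoIsPullback_hom_snd, pullback.lift_fst_assoc, Category.assoc,
          pullback.lift_snd]
    rw [this]; infer_instance
  have hb : IsPullback (b i) c l (pullback.fst (pullback.fst y g) (𝒱.f i)) := by
    refine (IsPullback.of_right (h₁₂ := pullback.snd (pullback.fst y g) (𝒱.f i))
      (h₂₂ := pullback.fst y g) ?_ ?_ hP.flip).flip
    · rw [pullback.lift_snd, pullback.lift_fst]; exact (h₁ i).flip
    · rw [pullback.lift_fst]
  have : c = hb.isoPullback.hom ≫ pullback.snd l _ := (hb.isoPullback_hom_snd).symm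
  have h : IsIso (pullback.snd l (pullback.fst (pullback.fst y g) (𝒱.f i))) := by
    rw [← (Iso.inv_comp_eq _).mpr this]
    infer_instance
  exact h

/-! ### Gluing the quotients. -/

namespace SemilinearAction

variable {k Ω : Type u} [Field k] [Field Ω] [Algebra k Ω] {X : Scheme.{u}}
  {f : X ⟶ Spec (CommRingCat.of Ω)} (S : SemilinearAction k f)

lemma toQuot_resLE_apply (W : S.StableAffine) (σ : Ω ≃ₐ[k] Ω) {u v : W.opens}
    (h : S.ρ σ u.1 = v.1) : S.toQuot W u = S.toQuot W v := by
  have h1 := congrArg (fun g : (W.opens : Scheme) ⟶ _ => g u) (S.resLE_toQuot W σ)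
  refine h1.symm.trans ?_
  refine (Scheme.Hom.comp_apply _ _ _).trans (congrArg _ (Subtype.ext ?_))
  have h2 := congrArg (fun g : (W.opens : Scheme) ⟶ _ => g u)
    (Scheme.Hom.resLE_comp_ι (S.ρ σ) (W.isStable.le σ))
  exact h2.trans h

lemma quotFunctor_map_toQuot {W W' : S.StableAffine} (h : W ⟶ W') (u : W.opens) :
    S.quotFunctor.map h (S.toQuot W u) = S.toQuot W' ⟨u.1, h.le u.2⟩ := by
  have h1 := congrArg (fun g : (W.opens : Scheme) ⟶ _ => g u) (S.toQuot_naturality h)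
  refine (Scheme.Hom.comp_apply _ _ _).symm.trans (h1.trans ?_)
  refine (Scheme.Hom.comp_apply _ _ _).trans (congrArg _ (Subtype.ext ?_))
  exact congrArg (fun g : (W.opens : Scheme) ⟶ _ => g u) (X.homOfLE_ι h.le)

variable [IsGalois k Ω]

/-- Both quotient squares are cartesian over the same Spec Ω → Spec k, hence so is the square
between them. Through it, the open immersion W → W' descends to the quotients. -/
lemma isPullback_homOfLE_toQuot (hc : S.HasContinuousSections) {W W' : S.StableAffine}
    (h : W ⟶ W') :
    IsPullback (S.toQuot W) (X.homOfLE h.le) (S.quotFunctor.map h) (S.toQuot W') := by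
  refine (IsPullback.of_right ?_ (S.toQuot_naturality h).symm
    (S.isPullback_toQuot hc W').flip).flip
  rw [Scheme.homOfLE_ι_assoc, S.quotFunctor_map_quotStr]
  exact (S.isPullback_toQuot hc W).flip

lemma surjective_toQuot (hc : S.HasContinuousSections) (W : S.StableAffine) :
    Surjective (S.toQuot W) :=
  MorphismProperty.of_isPullback (P := @Surjective) (S.isPullback_toQuot hc W).flip inferInstance

lemma flat_toQuot (hc : S.HasContinuousSections) (W : S.StableAffine) : Flat (S.toQuot W) :=
  MorphismProperty.of_isPullback (P := @Flat) (S.isPullback_toQuot hc W).flip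
    (Flat.SpecMap_iff.mpr (by
      rw [CommRingCat.hom_ofHom, RingHom.flat_algebraMap_iff]
      infer_instance))

lemma quasiCompact_toQuot (hc : S.HasContinuousSections) (W : S.StableAffine) :
    QuasiCompact (S.toQuot W) :=
  MorphismProperty.of_isPullback (P := @QuasiCompact) (S.isPullback_toQuot hc W).flip inferInstance

lemma isOpenImmersion_quotFunctor_map (hc : S.HasContinuousSections) {W W' : S.StableAffine}
    (h : W ⟶ W') : IsOpenImmersion (S.quotFunctor.map h) :=
  MorphismProperty.of_isPullback_of_descendsAlong (P := @IsOpenImmersion)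
    (Q := @Surjective ⊓ @Flat ⊓ @QuasiCompact) (S.isPullback_homOfLE_toQuot hc h).flip
    ⟨⟨S.surjective_toQuot hc W', S.flat_toQuot hc W'⟩, S.quasiCompact_toQuot hc W'⟩ inferInstance

lemma exists_ρ_eq_of_toQuot_eq (hc : S.HasContinuousSections) (W : S.StableAffine)
    {u v : W.opens} (h : S.toQuot W u = S.toQuot W v) : ∃ σ, S.ρ σ u.1 = v.1 := by
  obtain ⟨σ, hσ⟩ := exists_algEquiv_of_apply_eq (S.isPullback_toQuot hc W) h
  refine ⟨σ, ?_⟩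
  have h1 := hσ _ (S.resLE_toQuot W σ) (S.resLE_comm W σ)
  have h2 := congrArg (fun g : (W.opens : Scheme) ⟶ _ => g u)
    (Scheme.Hom.resLE_comp_ι (S.ρ σ) (W.isStable.le σ))
  exact h2.symm.trans (congrArg W.opens.ι h1)

/-- The intersection of stable affine opens. -/
def StableAffine.inf [X.IsSeparated] (W W' : S.StableAffine) : S.StableAffine where
  opens := W.opens ⊓ W'.opens
  isAffineOpen := W.isAffineOpen.inf W'.isAffineOpen
  isStable := W.isStable.inf W'.isStable

def StableAffine.infLeft [X.IsSeparated] (W W' : S.StableAffine) : W.inf S W' ⟶ W :=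
  homOfLE (show W.opens ⊓ W'.opens ≤ W.opens from inf_le_left)

def StableAffine.infRight [X.IsSeparated] (W W' : S.StableAffine) : W.inf S W' ⟶ W' :=
  homOfLE (show W.opens ⊓ W'.opens ≤ W'.opens from inf_le_right)

/-- This is the gluing condition. If points of the quotients of W₁ and W₂ agree in that of W₃, lifts
of them are conjugate; by stability the second lift lies in W₁ ⊓ W₂, whose quotient supplies the
common point. -/
lemma isLocallyDirected_quotFunctor [X.IsSeparated] (hc : S.HasContinuousSections) :
    (S.quotFunctor ⋙ Scheme.forget).IsLocallyDirected := by
  refine ⟨fun {W₁ W₂ W₃} h₁ h₂ x₁ x₂ hx => ?_⟩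
  obtain ⟨u, rfl⟩ := (S.surjective_toQuot hc W₁).surj x₁
  obtain ⟨v, rfl⟩ := (S.surjective_toQuot hc W₂).surj x₂
  have hx' := (S.quotFunctor_map_toQuot h₁ u).symm.trans (hx.trans (S.quotFunctor_map_toQuot h₂ v))
  obtain ⟨σ, hσ⟩ := S.exists_ρ_eq_of_toQuot_eq hc W₃ hx'
  have hv : v.1 ∈ W₁.opens := by
    rw [← hσ]; exact W₁.isStable.le σ u.2
  refine ⟨W₁.inf S W₂, W₁.infLeft S W₂, W₁.infRight S W₂,
    S.toQuot (W₁.inf S W₂) ⟨v.1, hv, v.2⟩, ?_, ?_⟩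
  · exact (S.quotFunctor_map_toQuot (W₁.infLeft S W₂) _).trans (S.toQuot_resLE_apply W₁ σ hσ).symm
  · exact S.quotFunctor_map_toQuot (W₁.infRight S W₂) _

instance [hc : Fact S.HasContinuousSections] {W W' : S.StableAffine} (h : W ⟶ W') :
    IsOpenImmersion (S.quotFunctor.map h) := S.isOpenImmersion_quotFunctor_map hc.out h

instance [hc : Fact S.HasContinuousSections] [X.IsSeparated] :
    (S.quotFunctor ⋙ Scheme.forget).IsLocallyDirected := S.isLocallyDirected_quotFunctor hc.out

variable [hc : Fact S.HasContinuousSections] [X.IsSeparated]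

/-- The open immersion of the quotient of a stable affine open into the glued quotient. -/
def quotι (W : S.StableAffine) : S.quotFunctor.obj W ⟶ colimit S.quotFunctor :=
  colimit.ι S.quotFunctor W

instance (W : S.StableAffine) : IsOpenImmersion (S.quotι W) :=
  inferInstanceAs (IsOpenImmersion (colimit.ι S.quotFunctor W))

/-- The equality is witnessed in the quotient of some W₀ mapping to both; a lift t of the witness is
conjugate to u and to v. -/
lemma exists_of_quotι_toQuot_eq {W W' : S.StableAffine} {u : W.opens} {v : W'.opens}
    (h : S.quotι W (S.toQuot W u) = S.quotι W' (S.toQuot W' v)) : ∃ σ, S.ρ σ u.1 = v.1 := by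
  obtain ⟨W₀, h₁, h₂, x, hx₁, hx₂⟩ := (Scheme.IsLocallyDirected.ι_eq_ι_iff S.quotFunctor).mp h
  obtain ⟨t, rfl⟩ := (S.surjective_toQuot hc.out W₀).surj x
  obtain ⟨σ, hσ⟩ := S.exists_ρ_eq_of_toQuot_eq hc.out W
    (hx₁.symm.trans (S.quotFunctor_map_toQuot h₁ t))
  obtain ⟨τ, hτ⟩ := S.exists_ρ_eq_of_toQuot_eq hc.out W'
    ((S.quotFunctor_map_toQuot h₂ t).symm.trans hx₂)
  exact ⟨σ * τ, by rw [S.ρ_mul_apply, hσ]; exact hτ⟩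

lemma homOfLE_toQuot_quotι {W W' : S.StableAffine} (h : W ⟶ W') :
    X.homOfLE h.le ≫ S.toQuot W' ≫ S.quotι W' = S.toQuot W ≫ S.quotι W := by
  rw [← Category.assoc, ← S.toQuot_naturality, Category.assoc]
  exact congrArg _ (colimit.w S.quotFunctor h)

/-- The structure morphism of the glued quotient. -/
def quotientStr : colimit S.quotFunctor ⟶ Spec (CommRingCat.of k) :=
  colimit.desc S.quotFunctor
    { pt := Spec (CommRingCat.of k)
      ι :=
        { app := S.quotStr
          naturality := fun _ _ h =>
            (S.quotFunctor_map_quotStr h).trans (Category.comp_id _).symm } }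

lemma quotι_quotientStr (W : S.StableAffine) : S.quotι W ≫ S.quotientStr = S.quotStr W :=
  colimit.ι_desc _ _

lemma exists_toQuotient (hcov : ∀ x : X, ∃ W : S.StableAffine, x ∈ W.opens) :
    ∃ p : X ⟶ colimit S.quotFunctor, ∀ W : S.StableAffine,
      W.opens.ι ≫ p = S.toQuot W ≫ S.quotι W := by
  let 𝒰 : X.OpenCover := X.openCoverOfIsOpenCover (fun W : S.StableAffine => W.opens)
    (TopologicalSpace.IsOpenCover.mk (by
      refine eq_top_iff.mpr fun x _ => ?_
      obtain ⟨W, hW⟩ := hcov x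
      exact TopologicalSpace.Opens.mem_iSup.mpr ⟨W, hW⟩))
  refine ⟨𝒰.glueMorphisms (fun W => S.toQuot W ≫ S.quotι W) fun W W' => ?_, fun W =>
    𝒰.ι_glueMorphisms _ _ W⟩
  have H := isPullback_opens_inf (X := X) W.opens W'.opens
  have h1 := (S.homOfLE_toQuot_quotι (W.infLeft S W')).trans
    (S.homOfLE_toQuot_quotι (W.infRight S W')).symm
  refine (cancel_epi H.isoPullback.hom).mp ?_
  refine (H.isoPullback_hom_fst_assoc _).trans (.trans ?_ (H.isoPullback_hom_snd_assoc _).symm)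
  exact h1

/-- Effectivity of descent for schemes covered by stable affine opens. -/
theorem exists_isPullback_of_stableAffine (hcov : ∀ x : X, ∃ W : S.StableAffine, x ∈ W.opens) :
    ∃ (X₀ : Scheme.{u}) (p : X ⟶ X₀) (s : X₀ ⟶ Spec (CommRingCat.of k)),
      (∀ σ, S.ρ σ ≫ p = p) ∧ IsPullback p f s (specMap (algebraMap k Ω)) := by
  obtain ⟨p, hp⟩ := S.exists_toQuotient hcov
  have hpapp (W : S.StableAffine) (u : W.opens) : p u.1 = S.quotι W (S.toQuot W u) :=
    congrArg (fun g : (W.opens : Scheme) ⟶ _ => g u) (hp W)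
  refine ⟨_, p, S.quotientStr, fun σ => ?_, ?_⟩
  · refine Scheme.hom_ext_of_forall _ _ fun x => ?_
    obtain ⟨W, hW⟩ := hcov x
    refine ⟨W.opens, hW, ?_⟩
    rw [← Scheme.Hom.resLE_comp_ι_assoc (S.ρ σ) (W.isStable.le σ), hp, ← Category.assoc,
      S.resLE_toQuot]
  · have w : p ≫ S.quotientStr = f ≫ specMap (algebraMap k Ω) := by
      refine Scheme.hom_ext_of_forall _ _ fun x => ?_
      obtain ⟨W, hW⟩ := hcov x
      refine ⟨W.opens, hW, ?_⟩
      rw [← Category.assoc, hp, Category.assoc, S.quotι_quotientStr, ← Category.assoc]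
      exact (S.isPullback_toQuot hc.out W).w
    -- W is the full preimage of its quotient: a point with image there is conjugate to a point of
    -- W, and W is stable.
    have h₁ (W : S.StableAffine) : IsPullback W.opens.ι (S.toQuot W) p (S.quotι W) := by
      refine (IsOpenImmersion.isPullback (S.toQuot W) W.opens.ι (S.quotι W) p (hp W) ?_).flip
      ext x
      rw [Scheme.Opens.opensRange_ι]
      constructor
      · rintro ⟨z, hz⟩
        obtain ⟨v, rfl⟩ := (S.surjective_toQuot hc.out W).surj z
        obtain ⟨W', hW'⟩ := hcov x
        obtain ⟨σ, hσ⟩ := S.exists_of_quotι_toQuot_eq (u := v) (v := ⟨x, hW'⟩)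
          (hz.trans (hpapp W' ⟨x, hW'⟩))
        rw [SetLike.mem_coe, ← show S.ρ σ v.1 = x from hσ]
        exact W.isStable.le σ v.2
      · intro hx
        exact ⟨_, (hpapp W ⟨x, hx⟩).symm⟩
    have h₂ (W : S.StableAffine) : IsPullback (S.toQuot W) (W.opens.ι ≫ f)
        (S.quotι W ≫ S.quotientStr) (specMap (algebraMap k Ω)) := by
      rw [S.quotι_quotientStr]
      exact S.isPullback_toQuot hc.out W
    exact isPullback_of_openCover w (Scheme.IsLocallyDirected.openCover S.quotFunctor)
      _ _ h₁ h₂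

end SemilinearAction

/-- The property of being an algebraic scheme descends along algebraic field extensions. -/
lemma isAlgebraicScheme_of_isPullback {k Ω : Type u} [Field k] [Field Ω] [Algebra k Ω]
    [Algebra.IsAlgebraic k Ω] {X X₀ : Scheme.{u}} {p : X ⟶ X₀} {f : X ⟶ Spec (CommRingCat.of Ω)}
    {s : X₀ ⟶ Spec (CommRingCat.of k)} (H : IsPullback p f s (specMap (algebraMap k Ω)))
    (hf : IsAlgebraicScheme (Over.mk f)) : IsAlgebraicScheme (Over.mk s) := by
  have hsep : IsSeparated f := hf.isSeparated
  have hft : LocallyOfFiniteType f := hf.locallyOfFiniteType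
  have hqc : QuasiCompact f := hf.quasiCompact
  have hint : IsIntegralHom (specMap (algebraMap k Ω)) := by
    rw [IsIntegralHom.SpecMap_iff, CommRingCat.hom_ofHom]
    exact fun x => Algebra.IsIntegral.isIntegral (R := k) x
  have hflat : Flat (specMap (algebraMap k Ω)) := Flat.SpecMap_iff.mpr (by
    rw [CommRingCat.hom_ofHom, RingHom.flat_algebraMap_iff]
    infer_instance)
  have hps : Surjective p :=
    MorphismProperty.of_isPullback (P := @Surjective) H.flip inferInstance
  have hpc : UniversallyClosed p :=
    MorphismProperty.of_isPullback (P := @UniversallyClosed) H.flip inferInstance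
  have : CompactSpace X := (quasiCompact_iff_compactSpace f).mp hqc
  have : CompactSpace X₀ := ⟨by
    rw [← Set.range_eq_univ.mpr hps.surj]
    exact isCompact_range p.continuous⟩
  refine ⟨?_, ?_, (quasiCompact_iff_compactSpace s).mpr this⟩
  -- For separatedness, the closed map m induced by p on fibre squares carries the diagonal of f
  -- onto the diagonal of s, as p is surjective.
  · have h2 : UniversallyClosed (pullback.map (f ≫ specMap (algebraMap k Ω))
        (f ≫ specMap (algebraMap k Ω)) s s p p (𝟙 _) (by rw [← H.w, Category.comp_id])
        (by rw [← H.w, Category.comp_id])) := by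
      exact MorphismProperty.pullbackMap (P := @UniversallyClosed) hpc hpc H.w.symm H.w.symm
    let m : pullback f f ⟶ pullback s s :=
      pullback.mapDesc f f (specMap (algebraMap k Ω)) ≫
        pullback.map _ _ s s p p (𝟙 _) (by rw [← H.w, Category.comp_id])
          (by rw [← H.w, Category.comp_id])
    have hm : UniversallyClosed m := inferInstance
    have hd : p ≫ pullback.diagonal s = pullback.diagonal f ≫ m := by
      have h3 : m ≫ pullback.fst s s = pullback.fst f f ≫ p := by
        refine (Category.assoc _ _ _).trans ((congrArg _ (pullback.lift_fst _ _ _)).trans ?_)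
        refine (Category.assoc _ _ _).symm.trans (congrArg (· ≫ p) ?_)
        exact (pullback.lift_fst _ _ _).trans (Category.comp_id _)
      have h4 : m ≫ pullback.snd s s = pullback.snd f f ≫ p := by
        refine (Category.assoc _ _ _).trans ((congrArg _ (pullback.lift_snd _ _ _)).trans ?_)
        refine (Category.assoc _ _ _).symm.trans (congrArg (· ≫ p) ?_)
        exact (pullback.lift_snd _ _ _).trans (Category.comp_id _)
      apply pullback.hom_ext <;> simp [h3, h4]
    have hr : Set.range (pullback.diagonal s) = m '' Set.range (pullback.diagonal f) := by
      rw [← Set.range_comp, ← hps.surj.range_comp]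
      exact congrArg Set.range (funext fun x =>
        congrArg (fun g : X ⟶ pullback s s => g x) hd)
    have hcl : IsClosed (Set.range (pullback.diagonal s)) := by
      rw [hr]
      exact m.isClosedMap _ (pullback.diagonal f).isClosedEmbedding.isClosed_range
    exact ⟨.of_isPreimmersion _ hcl⟩
  · exact MorphismProperty.of_isPullback_of_descendsAlong (P := @LocallyOfFiniteType)
      (Q := @Surjective ⊓ @Flat ⊓ @QuasiCompact) H.flip ⟨⟨inferInstance, hflat⟩, inferInstance⟩ hft

/-! ### Descent systems as semilinear actions, and the main criterion. -/

variable {k Ω : Type u} [Field k] [Field Ω] [Algebra k Ω]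

lemma baseChange_map_left_fst {F L : Type u} [Field F] [Field L] (i : F →+* L) {V W : Sch F}
    (g : V ⟶ W) : ((baseChange i).map g).left ≫ pullback.fst W.hom (specMap i) =
      pullback.fst V.hom (specMap i) ≫ g.left := by
  exact pullback.lift_fst _ _ _

namespace DescentSystem

variable {V : Sch Ω} (D : DescentSystem k V)

/-- The cocycle condition, inverted and projected to V, is multiplicativity of the associated
action. -/
lemma inv_left_fst_mul (σ τ : Ω ≃ₐ[k] Ω) :
    (D.φ (σ * τ)).inv.left ≫ pullback.fst V.hom (specMap ((σ * τ : Ω ≃ₐ[k] Ω) : Ω →+* Ω)) =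
      ((D.φ σ).inv.left ≫ pullback.fst V.hom (specMap (σ : Ω →+* Ω))) ≫
        (D.φ τ).inv.left ≫ pullback.fst V.hom (specMap (τ : Ω →+* Ω)) := by
  have h := D.cocycle σ τ
  have h1 : (D.φ (σ * τ)).inv = (D.φ σ).inv ≫ (baseChange (σ : Ω →+* Ω)).map (D.φ τ).inv ≫
      (baseChangeComp (coe_comp_coe k σ τ) V).hom := by
    rw [← cancel_mono (D.φ (σ * τ)).hom, Iso.inv_hom_id, Category.assoc, Category.assoc, ← h,
      ← Functor.map_comp_assoc, Iso.inv_hom_id, CategoryTheory.Functor.map_id, Category.id_comp,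
      Iso.inv_hom_id]
  rw [h1, Over.comp_left, Over.comp_left, Category.assoc, Category.assoc,
    baseChangeComp_hom_left_fst]
  refine (congrArg _ ?_).trans (Category.assoc _ _ _).symm
  refine (Category.assoc _ _ _).symm.trans
    ((congrArg (· ≫ pullback.fst V.hom (specMap (τ : Ω →+* Ω)))
      (baseChange_map_left_fst (σ : Ω →+* Ω) (D.φ τ).inv)).trans (Category.assoc _ _ _))

/-- The semilinear action attached to a descent system. -/
def semilinearAction : SemilinearAction k V.hom where
  ρ σ := (D.φ σ).inv.left ≫ pullback.fst V.hom (specMap (σ : Ω →+* Ω))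
  comm σ := by
    rw [Category.assoc, pullback.condition]
    exact Over.w_assoc (D.φ σ).inv _
  map_one := by
    -- Multiplicativity makes ρ 1 idempotent; being an isomorphism, it is the identity.
    have h := D.inv_left_fst_mul 1 1
    have h1 : IsIso (specMap ((1 : Ω ≃ₐ[k] Ω) : Ω →+* Ω)) :=
      inferInstanceAs (IsIso (Spec.map (𝟙 (CommRingCat.of Ω))))
    have h2 : IsIso (D.φ 1).inv.left := inferInstanceAs (IsIso ((Over.forget _).map (D.φ 1).inv))
    have h3 : IsIso (pullback.fst V.hom (specMap ((1 : Ω ≃ₐ[k] Ω) : Ω →+* Ω))) := inferInstance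
    have h4 := @IsIso.comp_isIso _ _ _ _ _ _ _ h2 h3
    exact (cancel_epi ((D.φ 1).inv.left ≫
      pullback.fst V.hom (specMap ((1 : Ω ≃ₐ[k] Ω) : Ω →+* Ω)))).mp
        (h.symm.trans (Category.comp_id _).symm)
  map_mul := D.inv_left_fst_mul

lemma hom_left_ρ (σ : Ω ≃ₐ[k] Ω) :
    (D.φ σ).hom.left ≫ D.semilinearAction.ρ σ = pullback.fst V.hom (specMap (σ : Ω →+* Ω)) := by
  change (D.φ σ).hom.left ≫ (D.φ σ).inv.left ≫ _ = _
  rw [← Category.assoc, ← Over.comp_left, Iso.hom_inv_id, Over.id_left]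
  exact Category.id_comp _

end DescentSystem

section Model

variable {F : Type u} [Field F] {i : F →+* Ω} {V : Sch Ω}

/-- The projection of a scheme onto a model. -/
def Model.proj (M : Model i V) : V.left ⟶ M.V₀.left :=
  M.φ.hom.left ≫ pullback.fst M.V₀.hom (specMap i)

lemma Model.isPullback_proj (M : Model i V) :
    IsPullback M.proj V.hom M.V₀.hom (specMap i) := by
  have h : IsIso M.φ.hom.left := inferInstanceAs (IsIso ((Over.forget _).map M.φ.hom))
  exact IsPullback.of_iso_pullback ⟨by
    rw [Model.proj, Category.assoc, pullback.condition]
    exact Over.w_assoc M.φ.hom _⟩ (asIso M.φ.hom.left) rfl (Over.w M.φ.hom)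

/-- A model splits a descent system if and only if the projection onto it is invariant. -/
lemma Model.splits_iff (M : Model i V) (D : DescentSystem k V) :
    M.Splits D ↔ ∀ σ : Ω ≃ₐ[k] Ω, (σ : Ω →+* Ω).comp i = i →
      D.semilinearAction.ρ σ ≫ M.proj = M.proj := by
  refine forall_congr' fun σ => forall_congr' fun hσ => ?_
  have h : IsIso (D.φ σ).hom.left := inferInstanceAs (IsIso ((Over.forget _).map (D.φ σ).hom))
  have h1 : ((baseChange (σ : Ω →+* Ω)).map M.φ.hom ≫ (baseChangeComp hσ M.V₀).hom).left ≫
      pullback.fst M.V₀.hom (specMap i) = (D.φ σ).hom.left ≫ D.semilinearAction.ρ σ ≫ M.proj := by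
    rw [Over.comp_left, Category.assoc, baseChangeComp_hom_left_fst, ← Category.assoc
      (D.φ σ).hom.left, D.hom_left_ρ]
    exact (Category.assoc _ _ _).symm.trans ((congrArg (· ≫ pullback.fst M.V₀.hom (specMap i))
      (baseChange_map_left_fst (σ : Ω →+* Ω) M.φ.hom)).trans (Category.assoc _ _ _))
  rw [← Category.assoc, Iso.eq_comp_inv]
  constructor
  · intro h2
    rw [← cancel_epi (D.φ σ).hom.left, ← h1, ← h2, Over.comp_left, Category.assoc, Model.proj]
  · intro h2
    rw [h2] at h1
    refine Over.OverMorphism.ext (pullback.hom_ext ?_ ?_)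
    · rw [h1, Over.comp_left, Category.assoc, Model.proj]
    · exact (Over.w ((D.φ σ).hom ≫ M.φ.hom)).trans (Over.w _).symm

lemma DescentSystem.isEffective_of_isPullback [Algebra.IsAlgebraic k Ω] (D : DescentSystem k V)
    (hV : IsAlgebraicScheme V) {X₀ : Scheme.{u}} {p : V.left ⟶ X₀}
    {s : X₀ ⟶ Spec (CommRingCat.of k)} (H : IsPullback p V.hom s (specMap (algebraMap k Ω)))
    (hp : ∀ σ, D.semilinearAction.ρ σ ≫ p = p) : D.IsEffective := by
  let M : Model (algebraMap k Ω) V :=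
    { V₀ := Over.mk s
      isAlgebraicScheme := isAlgebraicScheme_of_isPullback H hV
      φ := Over.isoMk H.isoPullback H.isoPullback_hom_snd }
  refine ⟨M, (M.splits_iff D).mpr fun σ _ => ?_⟩
  have h : M.proj = p := H.isoPullback_hom_fst
  rw [h, hp]

end Model

lemma IsAlgebraicScheme.left_isSeparated {V : Sch Ω} (hV : IsAlgebraicScheme V) :
    V.left.IsSeparated := by
  have := hV.isSeparated
  refine ⟨?_⟩
  rw [← terminal.comp_from V.hom]
  have : IsSeparated (terminal.from (Spec (CommRingCat.of Ω))) :=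
    (inferInstance : (Spec (CommRingCat.of Ω)).IsSeparated).1
  infer_instance

lemma IsAlgebraicScheme.isNoetherian {V : Sch Ω} (hV : IsAlgebraicScheme V) :
    IsNoetherian V.left := by
  have := hV.locallyOfFiniteType
  have := hV.quasiCompact
  have : CompactSpace V.left := (quasiCompact_iff_compactSpace V.hom).mp inferInstance
  have : IsNoetherianRing (CommRingCat.of Ω) := inferInstanceAs (IsNoetherianRing Ω)
  exact { LocallyOfFiniteType.isLocallyNoetherian V.hom with }

/-- Descent data are effective on schemes in which finite sets of closed points are contained in
open affines. -/
theorem descentIsEffective_of_finiteClosedSetsInAffine [IsGalois k Ω] {V : Sch Ω}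
    (hV : IsAlgebraicScheme V) (hfin : FiniteClosedSetsInAffine V.left) :
    DescentIsEffective k V := by
  rintro D ⟨K, ⟨t, rfl⟩, M, hM⟩
  rw [M.splits_iff] at hM
  have hM₀ := M.isAlgebraicScheme.left_isSeparated
  have hVs := hV.left_isSeparated
  have hVn := hV.isNoetherian
  -- Fixing the finite generating set t of K is the same as fixing K.
  have hq (σ : Ω ≃ₐ[k] Ω) (hσ : ∀ x ∈ (t : Set Ω), σ x = x) :
      D.semilinearAction.ρ σ ≫ M.proj = M.proj := by
    refine hM σ (RingHom.ext fun x => ?_)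
    exact IntermediateField.adjoin_induction k (p := fun x _ => σ x = x) hσ
      (fun x => σ.commutes x) (fun x y _ _ hx hy => by rw [map_add, hx, hy])
      (fun x _ hx => by rw [map_inv₀, hx]) (fun x y _ _ hx hy => by rw [map_mul, hx, hy]) x.2
  have hc : D.semilinearAction.HasContinuousSections :=
    D.semilinearAction.hasContinuousSections_of_isPullback M.isPullback_proj t.finite_toSet hq
      fun x hx => ⟨⟨x, IntermediateField.subset_adjoin k _ hx⟩, rfl⟩
  have hS : D.semilinearAction.HasFiniteOrbits :=
    D.semilinearAction.hasFiniteOrbits_of_isPullback M.isPullback_proj t.finite_toSet hq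
  have : Fact D.semilinearAction.HasContinuousSections := ⟨hc⟩
  obtain ⟨X₀, p, s, hp, H⟩ := D.semilinearAction.exists_isPullback_of_stableAffine fun x => by
    -- Every point specializes to a closed point z, and an open containing z contains its
    -- generizations.
    obtain ⟨z, hz, hzc⟩ := (isClosed_closure (s := {x})).exists_closed_singleton
      ⟨x, subset_closure rfl⟩
    obtain ⟨W, hW, hst, hzW⟩ := D.semilinearAction.exists_isStable_isAffineOpen hS hfin
      (Set.finite_singleton z) (by rintro _ rfl; exact hzc)
    refine ⟨⟨W, hW, hst⟩, ?_⟩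
    exact (specializes_iff_mem_closure.mpr hz).mem_open W.isOpen (hzW rfl)
  exact D.isEffective_of_isPullback hV H hp

lemma IsAlgebraicScheme.baseChange {F L : Type u} [Field F] [Field L] (i : F →+* L) {V : Sch F}
    (hV : IsAlgebraicScheme V) : IsAlgebraicScheme ((baseChange i).obj V) := by
  have := hV.isSeparated
  have := hV.locallyOfFiniteType
  have := hV.quasiCompact
  exact ⟨inferInstanceAs (IsSeparated (pullback.snd _ _)),
    inferInstanceAs (LocallyOfFiniteType (pullback.snd _ _)),
    inferInstanceAs (QuasiCompact (pullback.snd _ _))⟩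

/-! ### Finite sets in affine opens: descent along normal extensions. -/

section BaseChangeAction

variable {F : Type u} (E : Type u) [Field F] [Field E] [Algebra F E] (V : Sch F)

/-- The automorphism of `V_E` induced by an automorphism of `E/F`. -/
def baseChangeAut (σ : E ≃ₐ[F] E) :
    pullback V.hom (specMap (algebraMap F E)) ⟶ pullback V.hom (specMap (algebraMap F E)) :=
  pullback.lift (pullback.fst _ _) (pullback.snd _ _ ≫ specMap (σ : E →+* E)) (by
    have h : (σ : E →+* E).comp (algebraMap F E) = algebraMap F E := RingHom.ext σ.commutes
    rw [Category.assoc, ← specMap_comp, h]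
    exact pullback.condition)

lemma baseChangeAut_fst (σ : E ≃ₐ[F] E) :
    baseChangeAut E V σ ≫ pullback.fst _ _ = pullback.fst _ _ :=
  pullback.lift_fst _ _ _

lemma baseChangeAut_snd (σ : E ≃ₐ[F] E) :
    baseChangeAut E V σ ≫ pullback.snd _ _ = pullback.snd _ _ ≫ specMap (σ : E →+* E) :=
  pullback.lift_snd _ _ _

/-- The action of `Aut(E/F)` on `V_E`. -/
def baseChangeAction : SemilinearAction F (pullback.snd V.hom (specMap (algebraMap F E))) where
  ρ := baseChangeAut E V
  comm := baseChangeAut_snd E V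
  map_one := by
    refine pullback.hom_ext ?_ ?_
    · rw [baseChangeAut_fst, Category.id_comp]
    · rw [baseChangeAut_snd, Category.id_comp]
      exact (congrArg _ (Spec.map_id _)).trans (Category.comp_id _)
  map_mul σ τ := by
    refine pullback.hom_ext ?_ ?_
    · rw [Category.assoc, baseChangeAut_fst, baseChangeAut_fst, baseChangeAut_fst]
    · rw [Category.assoc, baseChangeAut_snd, baseChangeAut_snd, ← Category.assoc,
        baseChangeAut_snd, Category.assoc, ← specMap_comp]
      rfl

end BaseChangeAction

/-- The closed points lift to closed points of V_E, which lie in an affine open stable under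
Aut(E/F); such an open descends to V. -/
lemma finiteClosedSetsInAffine_of_baseChange {F E : Type u} [Field F] [Field E] [Algebra F E]
    [Normal F E] {V : Sch F} (hV : IsAlgebraicScheme V)
    (h : FiniteClosedSetsInAffine ((baseChange (algebraMap F E)).obj V).left) :
    FiniteClosedSetsInAffine V.left := by
  intro T hT hTc
  have hVs := hV.left_isSeparated
  have hEs : (pullback V.hom (specMap (algebraMap F E))).IsSeparated :=
    (hV.baseChange (algebraMap F E)).left_isSeparated
  have hEn : IsNoetherian (pullback V.hom (specMap (algebraMap F E))) :=
    (hV.baseChange (algebraMap F E)).isNoetherian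
  let q : pullback V.hom (specMap (algebraMap F E)) ⟶ V.left := pullback.fst _ _
  have H : IsPullback q (pullback.snd _ _) V.hom (specMap (algebraMap F E)) := .of_hasPullback _ _
  have hq (σ : E ≃ₐ[F] E) : (baseChangeAction E V).ρ σ ≫ q = q := baseChangeAut_fst E V σ
  have hS : (baseChangeAction E V).HasFiniteOrbits :=
    (baseChangeAction E V).hasFiniteOrbits_of_isPullback H Set.finite_empty fun σ _ => hq σ
  have hlift (x : V.left) (hx : x ∈ T) : ∃ z, q z = x ∧ IsClosed {z} := by
    obtain ⟨z, hz, hzc⟩ := ((hTc x hx).preimage q.continuous).exists_closed_singleton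
      ((inferInstance : Surjective q).surj x)
    exact ⟨z, hz, hzc⟩
  choose! g hg hgc using hlift
  obtain ⟨W, hW, hst, hTW⟩ := (baseChangeAction E V).exists_isStable_isAffineOpen hS h
    (hT.image g) (by rintro _ ⟨x, hx, rfl⟩; exact hgc x hx)
  obtain ⟨W₁, hW₁, rfl⟩ := exists_isAffineOpen_preimage_eq H hW fun σ =>
    ⟨_, hq σ, (baseChangeAction E V).comm σ, hst σ⟩
  exact ⟨W₁, hW₁, fun x hx => by
    have := hTW ⟨x, hx, rfl⟩
    rw [← hg x hx]
    exact this⟩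

/-- Over an algebraically closed field, the closed points are the rational points. -/
lemma FiniteRationalSetsInAffine.finiteClosedSetsInAffine {F : Type u} [Field F] [IsAlgClosed F]
    {V : Sch F} (hV : IsAlgebraicScheme V) (h : FiniteRationalSetsInAffine V) :
    FiniteClosedSetsInAffine V.left := by
  intro T hT hTc
  have := hV.locallyOfFiniteType
  have := hT.to_subtype
  let g (x : T) : Over.mk (𝟙 (Spec (CommRingCat.of F))) ⟶ V :=
    Over.homMk (pointOfClosedPoint V.hom x.1 (hTc x.1 x.2)) (pointOfClosedPoint_comp _ _ _)
  obtain ⟨U, hU, hTU⟩ := h (Set.range g) (Set.finite_range g)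
  exact ⟨U, hU, fun x hx => hTU _ ⟨⟨x, hx⟩, rfl⟩
    ⟨IsLocalRing.closedPoint F, pointOfClosedPoint_apply _ _ _ _⟩⟩

/-! ### Moving finite sets into a dense open. -/

section Topology

open scoped Pointwise

lemma isOpen_dense_biInter {ι X : Type*} [TopologicalSpace X] (t : Finset ι) (U : ι → Set X)
    (hU : ∀ i, IsOpen (U i)) (hd : ∀ i, Dense (U i)) :
    IsOpen (⋂ i ∈ t, U i) ∧ Dense (⋂ i ∈ t, U i) := by
  classical
  induction t using Finset.induction_on with
  | empty => simp
  | insert a t _ ih =>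
    rw [Finset.set_biInter_insert]
    exact ⟨(hU a).inter ih.1, (hd a).inter_of_isOpen_left ih.2 (hU a)⟩

/-- A finite set can be moved into a given dense open by a transitive action of a quasi-compact
group. -/
lemma exists_smul_mem_of_dense {Γ X : Type*} [Group Γ] [TopologicalSpace Γ] [CompactSpace Γ]
    [TopologicalSpace X] [MulAction Γ X] [MulAction.IsPretransitive Γ X]
    [ContinuousConstSMul Γ Γ] [ContinuousConstSMul Γ X]
    (ho : ∀ x : X, Continuous fun g : Γ => g • x) {U : Set X} (hU : IsOpen U) (hd : Dense U)
    {T : Set X} (hT : T.Finite) : ∃ g : Γ, ∀ x ∈ T, g • x ∈ U := by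
  -- If a nonempty open W missed this set, finitely many translates (h w⁻¹)W would cover Γ. The
  -- corresponding translates of U meet in a point γx. Writing γ = h w⁻¹ w' with w' ∈ W gives w'x ∈
  -- U, a contradiction.
  have key (x : X) : Dense {g : Γ | g • x ∈ U} := by
    refine dense_iff_inter_open.mpr fun W hW ⟨w, hw⟩ => ?_
    by_contra hne
    obtain ⟨t, ht⟩ := CompactSpace.elim_nhds_subcover (fun h : Γ => (h * w⁻¹) • W) fun h =>
      (hW.smul (h * w⁻¹)).mem_nhds ⟨w, hw, by simp⟩
    obtain ⟨-, h1⟩ := isOpen_dense_biInter t (fun h => (h * w⁻¹) • U)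
      (fun h => hU.smul _) fun h => hd.smul _
    have : Nonempty X := ⟨x⟩
    obtain ⟨y, hy⟩ := h1.nonempty
    obtain ⟨γ, rfl⟩ := MulAction.exists_smul_eq Γ x y
    have hγ : γ ∈ ⋃ h ∈ t, (h * w⁻¹) • W := ht ▸ Set.mem_univ γ
    simp only [Set.mem_iUnion] at hγ
    obtain ⟨h, hht, w', hw', rfl⟩ := hγ
    have h2 := Set.mem_iInter₂.mp hy h hht
    simp only [smul_eq_mul, mul_smul _ w' x] at h2
    have h3 : w' • x ∈ U := Set.smul_mem_smul_set_iff.mp h2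
    exact hne ⟨w', hw', h3⟩
  obtain ⟨-, h1⟩ := isOpen_dense_biInter hT.toFinset (fun x => {g : Γ | g • x ∈ U})
    (fun x => hU.preimage (ho x)) key
  obtain ⟨g, hg⟩ := h1.nonempty
  exact ⟨g, fun x hx => Set.mem_iInter₂.mp hg x (hT.mem_toFinset.mpr hx)⟩

end Topology

/-- A maximal affine open is dense: otherwise a disjoint nonempty affine open could be added, and a
disjoint union of two affines is affine. -/
lemma exists_dense_isAffineOpen (X : Scheme.{u}) [TopologicalSpace.NoetherianSpace X] :
    ∃ U : X.Opens, IsAffineOpen U ∧ Dense (U : Set X) := by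
  obtain ⟨U, hU, hmax⟩ := WellFounded.has_min
    (wellFounded_gt (α := TopologicalSpace.Opens X)) {U : X.Opens | IsAffineOpen U}
    ⟨⊥, isAffineOpen_bot X⟩
  refine ⟨U, hU, ?_⟩
  by_contra hd
  obtain ⟨x, hx⟩ := Set.nonempty_compl.mpr (mt dense_iff_closure_eq.mpr hd)
  obtain ⟨W, hW, hxW, hWU⟩ := exists_isAffineOpen_mem_and_subset
    (U := ⟨(closure (U : Set X))ᶜ, isClosed_closure.isOpen_compl⟩) hx
  have hdis : Disjoint U W := by
    rw [← TopologicalSpace.Opens.coe_disjoint]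
    exact (disjoint_compl_right.mono_right hWU).mono_left subset_closure
  refine hmax (U ⊔ W) (hU.sup_of_disjoint hW hdis) (lt_of_le_of_ne le_sup_left fun h => ?_)
  exact hx (subset_closure (h ▸ Or.inr hxW))

/-! ### Geometric points and transitive group actions. -/

section Points

open MonoidalCategory CartesianMonoidalCategory MonObj

variable {F : Type u} (E : Type u) [Field F] [Field E] [Algebra F E]

/-- The spectrum of an extension field as a scheme over the base field. -/
abbrev fieldPt : Sch F := Over.mk (specMap (algebraMap F E))

variable {E} {Z Z' : Sch F}

/-- The point of `Z_E` defined by an `E`-valued point of `Z`. -/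
def geomPoint (z : fieldPt E ⟶ Z) : (Z ⊗ fieldPt E).left :=
  (lift z (𝟙 (fieldPt E))).left (IsLocalRing.closedPoint E)

/-- Reduces Zariski continuity of a map on E-valued points to the existence of a morphism over E
inducing it. -/
lemma apply_geomPoint (φ : Z ⊗ fieldPt E ⟶ Z' ⊗ fieldPt E) (hφ : φ ≫ snd _ _ = snd _ _)
    (z : fieldPt E ⟶ Z) :
    φ.left (geomPoint z) = geomPoint (lift z (𝟙 (fieldPt E)) ≫ φ ≫ fst _ _) := by
  have h : lift (lift z (𝟙 (fieldPt E)) ≫ φ ≫ fst _ _) (𝟙 (fieldPt E)) =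
      lift z (𝟙 (fieldPt E)) ≫ φ := by
    refine CartesianMonoidalCategory.hom_ext _ _ ?_ ?_
    · rw [lift_fst, Category.assoc]
    · rw [lift_snd, Category.assoc, hφ, lift_snd]
  rw [geomPoint, geomPoint, h]
  rfl

lemma exists_geomPoint_eq [IsAlgClosed E] (hZ : IsAlgebraicScheme Z)
    {x : (Z ⊗ fieldPt E).left} (hx : IsClosed {x}) : ∃ z : fieldPt E ⟶ Z, geomPoint z = x := by
  have : LocallyOfFiniteType (snd Z (fieldPt E)).left :=
    (hZ.baseChange (algebraMap F E)).locallyOfFiniteType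
  have h1 := pointOfClosedPoint_comp (snd Z (fieldPt E)).left x hx
  let a : fieldPt E ⟶ Z ⊗ fieldPt E :=
    Over.homMk (pointOfClosedPoint (snd Z (fieldPt E)).left x hx) (by
      rw [← Over.w (snd Z (fieldPt E)), reassoc_of% h1])
  have ha : lift (a ≫ fst _ _) (𝟙 (fieldPt E)) = a := by
    refine CartesianMonoidalCategory.hom_ext _ _ (lift_fst _ _) ?_
    rw [lift_snd]
    exact Over.OverMorphism.ext h1.symm
  refine ⟨a ≫ fst _ _, ?_⟩
  rw [geomPoint, ha]
  exact pointOfClosedPoint_apply _ _ _ _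

variable (E) in
/-- The Zariski topology on the `E`-valued points. -/
abbrev pointsTopology (Z : Sch F) : TopologicalSpace (fieldPt E ⟶ Z) :=
  .induced geomPoint inferInstance

attribute [local instance] pointsTopology

lemma continuous_of_eq_lift_comp (φ : Z ⊗ fieldPt E ⟶ Z' ⊗ fieldPt E)
    (hφ : φ ≫ snd _ _ = snd _ _) {m : (fieldPt E ⟶ Z) → (fieldPt E ⟶ Z')}
    (hm : ∀ z, m z = lift z (𝟙 (fieldPt E)) ≫ φ ≫ fst _ _) : Continuous m := by
  refine continuous_induced_rng.mpr ?_
  have h : geomPoint ∘ m = φ.left ∘ geomPoint := by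
    funext z
    rw [Function.comp_apply, Function.comp_apply, apply_geomPoint φ hφ, hm]
  rw [h]
  exact φ.left.continuous.comp continuous_induced_dom

lemma isNoetherian_tensorObj_fieldPt (hZ : IsAlgebraicScheme Z) :
    IsNoetherian (Z ⊗ fieldPt E).left :=
  (hZ.baseChange (algebraMap F E)).isNoetherian

lemma compactSpace_points (hZ : IsAlgebraicScheme Z) : CompactSpace (fieldPt E ⟶ Z) := by
  have := isNoetherian_tensorObj_fieldPt (E := E) hZ
  have : TopologicalSpace.NoetherianSpace (fieldPt E ⟶ Z) :=
    (Topology.IsInducing.mk (f := geomPoint (Z := Z) (E := E)) rfl).noetherianSpace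
  infer_instance

/-- By the Jacobson property a nonempty open contains a closed point, and over an algebraically
closed E closed points come from E-valued points. -/
lemma dense_preimage_geomPoint [IsAlgClosed E] (hZ : IsAlgebraicScheme Z)
    {U : Set (Z ⊗ fieldPt E).left} (hU : IsOpen U) (hd : Dense U) :
    Dense (geomPoint (Z := Z) (E := E) ⁻¹' U) := by
  have hft : LocallyOfFiniteType (snd Z (fieldPt E)).left :=
    (hZ.baseChange (algebraMap F E)).locallyOfFiniteType
  have : JacobsonSpace (fieldPt (F := F) E).left :=
    inferInstanceAs (JacobsonSpace (PrimeSpectrum E))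
  have : JacobsonSpace (Z ⊗ fieldPt E).left :=
    LocallyOfFiniteType.jacobsonSpace (snd Z (fieldPt E)).left
  refine dense_iff_inter_open.mpr fun O hO hne => ?_
  obtain ⟨O', hO', rfl⟩ := isOpen_induced_iff.mp hO
  obtain ⟨z, hz⟩ := hne
  obtain ⟨x, hx, hxc⟩ := nonempty_inter_closedPoints
    (hd.inter_open_nonempty O' hO' ⟨_, hz⟩) (hO'.inter hU).isLocallyClosed
  obtain ⟨z, rfl⟩ := exists_geomPoint_eq hZ hxc
  exact ⟨z, hx⟩

variable {G V : Sch F} [GrpObj G] [ModObj G V]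

/-- The automorphism of `V_E` given by an `E`-valued point of a group scheme acting on `V`. -/
def translate (V : Sch F) [ModObj G V] (g : fieldPt E ⟶ G) : V ⊗ fieldPt E ⟶ V ⊗ fieldPt E :=
  lift ((snd V (fieldPt E) ≫ g) • fst V (fieldPt E)) (snd _ _)

lemma translate_snd (g : fieldPt E ⟶ G) : translate V g ≫ snd _ _ = snd _ _ := lift_snd _ _

lemma translate_mul (g h : fieldPt E ⟶ G) :
    translate V (g * h) = translate V h ≫ translate V g := by
  refine CartesianMonoidalCategory.hom_ext _ _ ?_ ?_
  · rw [Category.assoc, translate, translate, translate, lift_fst, lift_fst, ModObj.comp_smul,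
      lift_fst, lift_snd_assoc, MonObj.comp_mul, mul_smul]
  · rw [Category.assoc, translate_snd, translate_snd, translate_snd]

lemma translate_one : translate V (1 : fieldPt E ⟶ G) = 𝟙 _ := by
  refine CartesianMonoidalCategory.hom_ext _ _ ?_ ?_
  · rw [translate, lift_fst, MonObj.comp_one, one_smul, Category.id_comp]
  · rw [translate_snd, Category.id_comp]

instance (g : fieldPt E ⟶ G) : IsIso (translate V g) :=
  ⟨translate V g⁻¹, by rw [← translate_mul, inv_mul_cancel, translate_one],
    by rw [← translate_mul, mul_inv_cancel, translate_one]⟩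

lemma smul_eq_lift_comp_translate (g : fieldPt E ⟶ G) (x : fieldPt E ⟶ V) :
    g • x = lift x (𝟙 (fieldPt E)) ≫ translate V g ≫ fst _ _ := by
  rw [translate, lift_fst, ModObj.comp_smul, lift_fst, lift_snd_assoc, Category.id_comp]

/-- On a scheme with a transitive action of an algebraic group, every finite set of closed points
is contained in an affine open. -/
theorem ActsTransitively.finiteClosedSetsInAffine (hG : IsAlgebraicScheme G)
    (hV : IsAlgebraicScheme V) (h : ActsTransitively G V) : FiniteClosedSetsInAffine V.left := by
  let E := AlgebraicClosure F
  suffices FiniteClosedSetsInAffine (V ⊗ fieldPt E).left from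
    finiteClosedSetsInAffine_of_baseChange (E := E) hV this
  have hN := isNoetherian_tensorObj_fieldPt (E := E) hV
  have hΓ : CompactSpace (fieldPt E ⟶ G) := compactSpace_points hG
  have h1 : MulAction.IsPretransitive (fieldPt E ⟶ G) (fieldPt E ⟶ V) := ⟨h⟩
  -- Only translations and orbit maps need to be continuous; the Zariski topology on points is not
  -- treated as a group topology.
  have h2 : ContinuousConstSMul (fieldPt E ⟶ G) (fieldPt E ⟶ V) :=
    ⟨fun g => continuous_of_eq_lift_comp _ (translate_snd g) (smul_eq_lift_comp_translate g)⟩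
  have h3 : ContinuousConstSMul (fieldPt E ⟶ G) (fieldPt E ⟶ G) := ⟨fun g =>
    continuous_of_eq_lift_comp (lift ((snd _ _ ≫ g) * fst _ _) (snd _ _)) (lift_snd _ _) fun z => by
      rw [lift_fst, MonObj.comp_mul, lift_fst, lift_snd_assoc, Category.id_comp, smul_eq_mul]⟩
  have h4 (x : fieldPt E ⟶ V) : Continuous fun g : fieldPt E ⟶ G => g • x :=
    continuous_of_eq_lift_comp (lift (fst _ _ • (snd _ _ ≫ x)) (snd _ _)) (lift_snd _ _) fun z => by
      rw [lift_fst, ModObj.comp_smul, lift_fst, lift_snd_assoc, Category.id_comp]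
  intro T hT hTc
  have := hT.to_subtype
  obtain ⟨U, hU, hd⟩ := exists_dense_isAffineOpen (V ⊗ fieldPt E).left
  choose z hz using fun x : T => exists_geomPoint_eq (E := E) hV (hTc x.1 x.2)
  obtain ⟨g, hg⟩ := exists_smul_mem_of_dense h4 (U.isOpen.preimage continuous_induced_dom)
    (dense_preimage_geomPoint hV U.isOpen hd) (Set.finite_range z)
  have hiso : IsIso (translate V g).left :=
    inferInstanceAs (IsIso ((Over.forget _).map (translate V g)))
  refine ⟨(translate V g).left ⁻¹ᵁ U, hU.preimage _, fun x hx => ?_⟩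
  have h5 := hg (z ⟨x, hx⟩) ⟨_, rfl⟩
  rw [Set.mem_preimage, smul_eq_lift_comp_translate, ← apply_geomPoint _ (translate_snd g), hz] at h5
  exact h5

end Points

/-! ### Homogeneous prime avoidance and quasi-projective schemes. -/

section HomogeneousPrimeAvoidance

variable {A σ : Type u} [CommRing A] [SetLike σ A] [AddSubgroupClass σ A] (𝒜 : ℕ → σ)
  [GradedRing 𝒜]

lemma exists_homogeneous_notMem {I : HomogeneousIdeal 𝒜} {p : Ideal A} (h : ¬ I.toIdeal ≤ p) :
    ∃ n, ∃ a ∈ 𝒜 n, a ∈ I ∧ a ∉ p := by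
  classical
  by_contra! hall
  refine h fun x hx => ?_
  rw [← DirectSum.sum_support_decompose 𝒜 x]
  exact sum_mem fun i _ => hall i _ (SetLike.coe_mem _) (I.isHomogeneous i hx)

/-- Multiplying by a homogeneous element of the irrelevant ideal outside p makes the degree
positive, since that ideal has zero part in degree 0. -/
lemma exists_homogeneous_pos_notMem {I : HomogeneousIdeal 𝒜} (p : ProjectiveSpectrum 𝒜)
    (h : ¬ I.toIdeal ≤ p.asHomogeneousIdeal.toIdeal) :
    ∃ n > 0, ∃ a ∈ 𝒜 n, a ∈ I ∧ a ∉ p.asHomogeneousIdeal.toIdeal := by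
  obtain ⟨n, a, ha, haI, hap⟩ := exists_homogeneous_notMem 𝒜 h
  obtain ⟨m, b, hb, hbI, hbp⟩ := exists_homogeneous_notMem 𝒜 p.not_irrelevant_le
  have hm : m ≠ 0 := by
    rintro rfl
    rw [HomogeneousIdeal.mem_irrelevant_iff, GradedRing.proj_apply,
      DirectSum.decompose_of_mem_same 𝒜 hb] at hbI
    exact hbp (hbI ▸ zero_mem _)
  exact ⟨n + m, by omega, a * b, SetLike.mul_mem_graded ha hb, Ideal.mul_mem_right _ _ haI,
    fun h => (p.isPrime.mem_or_mem h).elim hap hbp⟩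

/-- Homogeneous prime avoidance. -/
lemma exists_homogeneous_forall_notMem (I : HomogeneousIdeal 𝒜)
    (S : Finset (ProjectiveSpectrum 𝒜))
    (hS : ∀ p ∈ S, ¬ I.toIdeal ≤ p.asHomogeneousIdeal.toIdeal) :
    ∃ n > 0, ∃ a ∈ 𝒜 n, a ∈ I ∧ ∀ p ∈ S, a ∉ p.asHomogeneousIdeal.toIdeal := by
  classical
  induction S using Finset.strongInduction with
  | H S ih =>
    obtain rfl | hne := S.eq_empty_or_nonempty
    · exact ⟨1, one_pos, 0, zero_mem _, zero_mem _, by simp⟩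
    -- Minimality ensures that no other member of S is contained in p, so each has a homogeneous
    -- element outside p.
    obtain ⟨p, hp, hmin⟩ := S.exists_minimal hne
    obtain ⟨n, hn, f, hf, hfI, hfS⟩ := ih _ (Finset.erase_ssubset hp) fun q hq =>
      hS q (Finset.mem_of_mem_erase hq)
    by_cases hfp : f ∈ p.asHomogeneousIdeal.toIdeal
    swap
    · refine ⟨n, hn, f, hf, hfI, fun q hq => ?_⟩
      obtain rfl | hqp := eq_or_ne q p
      · exact hfp
      · exact hfS q (Finset.mem_erase.mpr ⟨hqp, hq⟩)
    obtain ⟨m, hm, a, ha, haI, hap⟩ := exists_homogeneous_pos_notMem 𝒜 p (hS p hp)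
    have hq (q : ProjectiveSpectrum 𝒜) (hq : q ∈ S.erase p) : ∃ m, ∃ b ∈ 𝒜 m,
        b ∈ q.asHomogeneousIdeal ∧ b ∉ p.asHomogeneousIdeal.toIdeal := by
      refine exists_homogeneous_notMem 𝒜 fun hle => ?_
      have h1 : q ≤ p := hle
      have h2 : p ≤ q := hmin (Finset.mem_of_mem_erase hq) h1
      exact Finset.ne_of_mem_erase hq (le_antisymm h1 h2)
    choose! d b hb hbq hbp using hq
    -- g lies in I and in every q ≠ p but not in p, complementary to f. The powers `f ^ e` and `g ^
    -- n` have the same degree, so their sum is homogeneous and avoids all of S.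
    let g := a * ∏ q ∈ S.erase p, b q
    let e := m + ∑ q ∈ S.erase p, d q
    have hg : g ∈ 𝒜 e := SetLike.mul_mem_graded ha (SetLike.prod_mem_graded 𝒜 _ _ hb)
    have hgI : g ∈ I := Ideal.mul_mem_right _ _ haI
    have hgp : g ∉ p.asHomogeneousIdeal.toIdeal := fun h =>
      (p.isPrime.mem_or_mem h).elim hap fun h => by
        obtain ⟨q, hq, h⟩ := (Ideal.IsPrime.prod_mem_iff (hp := p.isPrime)).mp h
        exact hbp q hq h
    have he : 0 < e := by omega
    refine ⟨e * n, Nat.mul_pos he hn, f ^ e + g ^ n, add_mem ?_ ?_, add_mem ?_ ?_, fun q hq => ?_⟩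
    · exact SetLike.pow_mem_graded e hf
    · rw [mul_comm]; exact SetLike.pow_mem_graded n hg
    · exact Ideal.pow_mem_of_mem _ hfI _ he
    · exact Ideal.pow_mem_of_mem _ hgI _ hn
    obtain rfl | hqp := eq_or_ne q p
    · rw [Ideal.add_mem_iff_right _ (Ideal.pow_mem_of_mem _ hfp _ he)]
      exact fun h => hgp (q.isPrime.mem_of_pow_mem _ h)
    · have hq' := Finset.mem_erase.mpr ⟨hqp, hq⟩
      have hgq : g ∈ q.asHomogeneousIdeal.toIdeal :=
        Ideal.mul_mem_left _ _ (Ideal.mem_of_dvd _ (Finset.dvd_prod_of_mem b hq') (hbq q hq'))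
      rw [Ideal.add_mem_iff_left _ (Ideal.pow_mem_of_mem _ hgq _ hn)]
      exact fun h => hfS q hq' (q.isPrime.mem_of_pow_mem _ h)

/-- A finite set in a subscheme of `Proj` is contained in an affine open. -/
lemma exists_isAffineOpen_of_isImmersion {X : Scheme.{u}} (j : X ⟶ Proj 𝒜) [IsImmersion j]
    {T : Set X} (hT : T.Finite) : ∃ U : X.Opens, IsAffineOpen U ∧ T ⊆ U := by
  classical
  -- The boundary of the image, closed because the image is locally closed; a must vanish on it and
  -- at no point of j(T).
  let Z : Set (ProjectiveSpectrum 𝒜) := closure (Set.range j) \ Set.range j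
  have hZ : IsClosed Z :=
    isOpen_compl_iff.mp j.isLocallyClosed_range.isOpen_coborder
  have hfin : {p : ProjectiveSpectrum 𝒜 | ∃ x ∈ T, j x = p}.Finite := hT.image j
  obtain ⟨n, hn, a, ha, haI, haT⟩ := exists_homogeneous_forall_notMem 𝒜
    (ProjectiveSpectrum.vanishingIdeal Z)
    hfin.toFinset (by
      intro p hp hle
      rw [Set.Finite.mem_toFinset] at hp
      obtain ⟨x, -, rfl⟩ := hp
      have h1 : j x ∈ ProjectiveSpectrum.zeroLocus 𝒜
        (ProjectiveSpectrum.vanishingIdeal Z : Set A) := hle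
      rw [ProjectiveSpectrum.zeroLocus_vanishingIdeal_eq_closure, hZ.closure_eq] at h1
      exact h1.2 ⟨x, rfl⟩)
  let D : (Proj 𝒜).Opens := Proj.basicOpen 𝒜 a
  have hD : IsAffineOpen D := Proj.isAffineOpen_basicOpen 𝒜 a ha hn
  have hDZ : Disjoint (D : Set (Proj 𝒜)) Z := by
    refine Set.disjoint_left.mpr fun x hx hxZ => hx ?_
    exact (ProjectiveSpectrum.mem_vanishingIdeal Z a).mp haI x hxZ
  refine ⟨j ⁻¹ᵁ D, ?_, fun x hx => haT (j x)
    (hfin.mem_toFinset.mpr ⟨x, hx, rfl⟩)⟩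
  -- Away from the boundary the image is closed, so the preimage of the affine D is a closed
  -- subscheme of D.
  have hcl : IsClosedImmersion (j ∣_ D) := by
    refine .of_isPreimmersion _ ?_
    have h : Set.range (j ∣_ D) = D.ι ⁻¹' (closure (Set.range j)) := by
      ext y
      constructor
      · rintro ⟨x, rfl⟩
        exact subset_closure ⟨x.1, (morphismRestrict_base_coe j D x).symm⟩
      · intro hy
        obtain ⟨x, hx⟩ : y.1 ∈ Set.range j := by
          by_contra hne
          exact Set.disjoint_left.mp hDZ y.2 ⟨hy, hne⟩
        refine ⟨⟨x, show j x ∈ D from hx ▸ y.2⟩, Subtype.ext ?_⟩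
        exact (morphismRestrict_base_coe j D _).trans hx
    rw [h]
    exact isClosed_closure.preimage D.ι.continuous
  have : IsAffine D := hD
  exact isAffine_of_isAffineHom (j ∣_ D)

end HomogeneousPrimeAvoidance

attribute [local instance] MvPolynomial.gradedAlgebra in
/-- Every finite set in a quasi-projective scheme is contained in an affine open. -/
lemma IsQuasiProjective.finiteClosedSetsInAffine {F : Type u} [Field F] {V : Sch F}
    (hV : IsQuasiProjective V) : FiniteClosedSetsInAffine V.left := by
  obtain ⟨n, j, hj⟩ := hV
  let j' : V.left ⟶ Proj (MvPolynomial.homogeneousSubmodule (Fin (n + 1)) F) := j.left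
  have : IsImmersion j' := hj
  exact fun T hT _ => exists_isAffineOpen_of_isImmersion _ j' hT

end FieldDescent

end

theorem corollary6p3 {k Ω : Type u} [Field k] [Field Ω] [Algebra k Ω] [IsGalois k Ω]
    (V : FieldDescent.Sch Ω) (hV : FieldDescent.IsAlgebraicScheme V) :
    (FieldDescent.IsQuasiProjective V → FieldDescent.DescentIsEffective k V) ∧
    (∀ (G : FieldDescent.Sch Ω) [GrpObj G] [ModObj G V],
      FieldDescent.IsAlgebraicScheme G → IsAffine G.left →
      FieldDescent.ActsTransitively G V → FieldDescent.DescentIsEffective k V) ∧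
    (∀ (Ωs : Type u) [Field Ωs] [Algebra Ω Ωs] [IsSepClosure Ω Ωs],
      FieldDescent.FiniteClosedSetsInAffine
        ((FieldDescent.baseChange (algebraMap Ω Ωs)).obj V).left →
      FieldDescent.DescentIsEffective k V) ∧
    (PerfectField k → ∀ (Ωs : Type u) [Field Ωs] [Algebra Ω Ωs] [IsSepClosure Ω Ωs],
      FieldDescent.FiniteRationalSetsInAffine
        ((FieldDescent.baseChange (algebraMap Ω Ωs)).obj V) →
      FieldDescent.DescentIsEffective k V) := by
  refine ⟨fun h => ?_, fun G _ _ hG _ h => ?_, fun Ωs _ _ _ h => ?_, fun _ Ωs _ _ _ h => ?_⟩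
  · exact FieldDescent.descentIsEffective_of_finiteClosedSetsInAffine hV h.finiteClosedSetsInAffine
  · exact FieldDescent.descentIsEffective_of_finiteClosedSetsInAffine hV
      (h.finiteClosedSetsInAffine hG hV)
  -- A separable closure is normal, so the condition descends from it.
  · exact FieldDescent.descentIsEffective_of_finiteClosedSetsInAffine hV
      (FieldDescent.finiteClosedSetsInAffine_of_baseChange (E := Ωs) hV h)
  -- An algebraic extension of a perfect field is perfect, so Ωs is algebraically closed and closed
  -- points are rational.
  · have : PerfectField Ω := Algebra.IsAlgebraic.perfectField (K := k)
    have : IsAlgClosed Ωs := (inferInstance : IsAlgClosure Ω Ωs).isAlgClosed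
    exact FieldDescent.descentIsEffective_of_finiteClosedSetsInAffine hV
      (FieldDescent.finiteClosedSetsInAffine_of_baseChange (E := Ωs) hV
        (h.finiteClosedSetsInAffine (hV.baseChange _)))
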